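/- **Definitions.** Let $(X,d)$ be a metric space. For $A\subset X$ and $L\ge 0$ put $A^{+L}=\{x\in X: d(x,A)\le L\}$ (with $d(x,\emptyset)=\infty$). A *$k$-path* in $Y\subset X$ is a finite sequence of points of $Y$ with consecutive points at distance $\le k$; $Y$ is *$k$-coarsely connected* if any two of its points are joined by a $k$-path in $Y$; the classes of the relation "being joined by a $k$-path" are the $k$-coarsely connected components. A subspace $Y\subset X$ is *coarsely separated* by a family $\mathcal Z$ of subsets of $X$ if there are $k,L\ge 0$ such that $Y$ is $k$-coarsely connected and such that, for every $D\ge 0$, there is $Z\in\mathcal Z$ for which $Y\setminus Z^{+L}$ has at least two $k$-coarsely connected components containing points at distance $\ge D$ from $Z$. A map $f:X\to X'$ is a *coarse embedding* if there are non-decreasing $\sigma_1,\sigma_2$ with $\sigma_1(t)\to\infty$ as $t\to\infty$ and $\sigma_1(d(x,y))\le d(f(x),f(y))\le\sigma_2(d(x,y))$ for all $x,y\in X$. Connected graphs (i.e. their vertex sets) carry the shortest path metric, finitely generated groups the word metric of an arbitrary finite generating set. A family $\mathcal S$ of subsets of a graph $X$ has *growth $O(r^c)$* if $\sup_{S\in\mathcal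 S,\,s\in S}|B(s,r)\cap S|=O(r^c)$ as $r\to\infty$. Given a graph $\Gamma$ and groups $\mathcal G=\{G_u\}_{u\in V(\Gamma)}$, the *graph product* $\Gamma\mathcal G$ is the quotient of the free product of the $G_u$ by the normal closure of all $[g,h]$ with $g\in G_u$, $h\in G_v$, $\{u,v\}\in E(\Gamma)$; the *right-angled Artin group* $A(\Gamma)$ is the case $G_u=\mathbb Z$ for all $u$. A *clique-subgroup* is a subgroup $\langle\Lambda\rangle$ generated by the vertex-groups of the vertices of a (possibly empty) clique $\Lambda$ of $\Gamma$. A graph is *chordal* if it has no induced cycle of length $\ge 4$, and $\mathrm{clique}(\Gamma)$ is the largest number of vertices of a clique of $\Gamma$. **Theorem.** Let $\Gamma$ be a finite chordal graph. 1. Let $\mathcal G$ be a collection of finitely generated groups indexed by $V(\Gamma)$, let $Z$ be a geodesic metric space and let $\rho:Z\to\Gamma\mathcal G$ be a coarse embedding. Then either there are $R\geq 0$ and a left coset $A$ of a clique-subgroup with $\rho(Z)\subset A^{+R}$, or $\rho(Z)$ is coarsely separated by the family of all left cosets of clique-subgroups. 2. Let $X$ be an infinite connected graph of bounded degree that is not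 coarsely separated by any family of subsets of growth $O(r^{\mathrm{clique}(\Gamma)})$. Then there is no coarse embedding of $X$ into the right-angled Artin group $A(\Gamma)$. 3. Real hyperbolic space $\mathbb H^3$ does not coarsely embed into $A(\Gamma)$. -/

import Mathlib

noncomputable section

namespace ChordalCoarse

/-! ### Coarse geometry of metric spaces -/

section Coarse

/-- There is a `k`-path in `Y` from `a` to `b`: a finite sequence of points of `Y`, from `a` to `b`,
with consecutive points at distance at most `k`. -/
def JoinedByPath {X : Type*} [MetricSpace X] (k : ℝ) (Y : Set X) (a b : X) : Prop :=
  ∃ (n : ℕ) (p : ℕ → X), p 0 = a ∧ p n = b ∧ (∀ i ≤ n, p i ∈ Y) ∧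
    ∀ i < n, dist (p i) (p (i + 1)) ≤ k

/-- `Y` is `k`-coarsely connected: any two points of `Y` are joined by a `k`-path in `Y`. -/
def IsCoarselyConnected {X : Type*} [MetricSpace X] (k : ℝ) (Y : Set X) : Prop :=
  ∀ a ∈ Y, ∀ b ∈ Y, JoinedByPath k Y a b

/-- `Y` is coarsely separated by the family `𝒵`: there are `k, L ≥ 0` such that `Y` is `k`-coarsely
connected and, for every `D ≥ 0`, some `Z ∈ 𝒵` is such that two distinct `k`-coarsely connected
components of `Y \ Z^{+L}` contain points at distance at least `D` from `Z`. Here `Z^{+L}` is the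
closed `L`-neighbourhood `{x | d(x, Z) ≤ L}`, and distances to the empty set are infinite. -/
def CoarselySeparatedBy {X : Type*} [MetricSpace X] (Y : Set X) (𝒵 : Set (Set X)) : Prop :=
  ∃ k L : ℝ, 0 ≤ k ∧ 0 ≤ L ∧ IsCoarselyConnected k Y ∧
    ∀ D : ℝ, 0 ≤ D → ∃ Z ∈ 𝒵,
      ∃ a ∈ Y \ Metric.cthickening L Z, ∃ b ∈ Y \ Metric.cthickening L Z,
        ENNReal.ofReal D ≤ Metric.infEDist a Z ∧ ENNReal.ofReal D ≤ Metric.infEDist b Z ∧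
        ¬ JoinedByPath k (Y \ Metric.cthickening L Z) a b

/-- `f` is a coarse embedding: there are non-decreasing control functions `σ₁, σ₂`, with
`σ₁(t) → ∞` as `t → ∞`, such that `σ₁(d(x, y)) ≤ d(f x, f y) ≤ σ₂(d(x, y))`. -/
def IsCoarseEmbedding {X Y : Type*} [MetricSpace X] [MetricSpace Y] (f : X → Y) : Prop :=
  ∃ σ₁ σ₂ : ℝ → ℝ, Monotone σ₁ ∧ Monotone σ₂ ∧ Filter.Tendsto σ₁ Filter.atTop Filter.atTop ∧
    ∀ x y, σ₁ (dist x y) ≤ dist (f x) (f y) ∧ dist (f x) (f y) ≤ σ₂ (dist x y)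

/-- Any two points are the endpoints of a geodesic segment. -/
def IsGeodesicSpace (X : Type*) [MetricSpace X] : Prop :=
  ∀ x y : X, ∃ γ : ℝ → X, γ 0 = x ∧ γ (dist x y) = y ∧
    ∀ s ∈ Set.Icc 0 (dist x y), ∀ t ∈ Set.Icc 0 (dist x y), dist (γ s) (γ t) = |s - t|

/-- The volume growth `V_𝒮(r) = sup {|B(s, r) ∩ S| : S ∈ 𝒮, s ∈ S}` of a family of subsets, with
cardinality as volume. -/
def volumeGrowth {X : Type*} [MetricSpace X] (𝒮 : Set (Set X)) (r : ℝ) : ℕ∞ :=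
  ⨆ S ∈ 𝒮, ⨆ s ∈ S, (Metric.closedBall s r ∩ S).encard

/-- The family `𝒮` has growth `O(r^c)`. -/
def HasGrowthBigO {X : Type*} [MetricSpace X] (𝒮 : Set (Set X)) (c : ℕ) : Prop :=
  ∃ C : NNReal, ∀ᶠ r : ℝ in Filter.atTop,
    (volumeGrowth 𝒮 r : ENNReal) ≤ C * ENNReal.ofReal r ^ c

end Coarse

/-! ### Graphs as metric spaces -/

section Graphs

/-- A graph is chordal if it has no induced cycle of length at least four. -/
def IsChordal {V : Type*} (Γ : SimpleGraph V) : Prop :=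
  ∀ n : ℕ, 4 ≤ n → IsEmpty (SimpleGraph.cycleGraph n ↪g Γ)

/-- A graph has bounded degree if there is a uniform finite bound on its vertex degrees. -/
def HasBoundedDegree {W : Type*} (X : SimpleGraph W) : Prop :=
  ∃ d : ℕ, ∀ x, (X.neighborSet x).encard ≤ d

/-- The shortest path metric on the vertex set of a connected graph. -/
@[reducible]
def pathMetric {W : Type*} (X : SimpleGraph W) (hX : X.Connected) : MetricSpace W where
  dist x y := (X.dist x y : ℝ)
  dist_self _ := by simp
  dist_comm x y := by rw [SimpleGraph.dist_comm]
  dist_triangle x y z := by exact_mod_cast hX.dist_triangle (u := x) (v := y) (w := z)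
  eq_of_dist_eq_zero {x y} h := hX.dist_eq_zero_iff.1 (by exact_mod_cast h)

/-- The vertex set of a connected graph, endowed with the shortest path metric. -/
def GraphSpace {W : Type*} (X : SimpleGraph W) (_hX : X.Connected) : Type _ := W

instance {W : Type*} (X : SimpleGraph W) (hX : X.Connected) : MetricSpace (GraphSpace X hX) :=
  pathMetric X hX

end Graphs

/-! ### Finitely generated groups as metric spaces -/

section WordMetric

/-- The word length of `g` with respect to `S`: the least length of a word in `S ∪ S⁻¹` that
represents `g`. -/
def wordLength {G : Type*} [Group G] (S : Set G) (g : G) : ℕ :=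
  sInf {n | ∃ l : List G, l.length = n ∧ (∀ x ∈ l, x ∈ S ∨ x⁻¹ ∈ S) ∧ l.prod = g}

theorem exists_word {G : Type*} [Group G] {S : Set G} (hS : Subgroup.closure S = ⊤) (g : G) :
    ∃ l : List G, l.length = wordLength S g ∧ (∀ x ∈ l, x ∈ S ∨ x⁻¹ ∈ S) ∧ l.prod = g := by
  have hg : g ∈ Subgroup.closure S := by rw [hS]; trivial
  rw [← Subgroup.mem_toSubmonoid, Subgroup.closure_toSubmonoid] at hg
  obtain ⟨l, h1, h2⟩ := Submonoid.exists_list_of_mem_closure hg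
  exact Nat.sInf_mem (s := {n | ∃ l : List G, l.length = n ∧ (∀ x ∈ l, x ∈ S ∨ x⁻¹ ∈ S) ∧
    l.prod = g}) ⟨l.length, l, rfl, h1, h2⟩

theorem wordLength_le {G : Type*} [Group G] {S : Set G} (l : List G)
    (h : ∀ x ∈ l, x ∈ S ∨ x⁻¹ ∈ S) : wordLength S l.prod ≤ l.length :=
  Nat.sInf_le ⟨l, rfl, h, rfl⟩

theorem wordLength_one {G : Type*} [Group G] (S : Set G) : wordLength S (1 : G) = 0 := by
  simpa using wordLength_le (S := S) ([] : List G) (by simp)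

theorem wordLength_inv_le {G : Type*} [Group G] {S : Set G} (hS : Subgroup.closure S = ⊤) (g : G) :
    wordLength S g⁻¹ ≤ wordLength S g := by
  obtain ⟨l, h1, h2, rfl⟩ := exists_word hS g
  rw [List.prod_inv_reverse, ← h1]
  refine (wordLength_le _ ?_).trans (by simp)
  intro x hx
  simp only [List.mem_reverse, List.mem_map] at hx
  obtain ⟨y, hy, rfl⟩ := hx
  simpa using (h2 y hy).symm

theorem wordLength_mul_le {G : Type*} [Group G] {S : Set G} (hS : Subgroup.closure S = ⊤)
    (g h : G) : wordLength S (g * h) ≤ wordLength S g + wordLength S h := by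
  obtain ⟨l, h1, h2, h3⟩ := exists_word hS g
  obtain ⟨m, k1, k2, k3⟩ := exists_word hS h
  rw [← h1, ← k1, ← List.length_append]
  have := wordLength_le (S := S) (l ++ m) (by
    intro x hx
    rcases List.mem_append.1 hx with hx | hx
    · exact h2 x hx
    · exact k2 x hx)
  rwa [List.prod_append, h3, k3] at this

/-- The word metric `d(g, h) = |g⁻¹ h|_S` of a generating set `S`. -/
@[reducible]
def wordMetric {G : Type*} [Group G] (S : Set G) (hS : Subgroup.closure S = ⊤) :
    MetricSpace G where
  dist g h := (wordLength S (g⁻¹ * h) : ℝ)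
  dist_self g := by rw [inv_mul_cancel, wordLength_one, Nat.cast_zero]
  dist_comm g h := by
    have key : ∀ a b : G, wordLength S (a⁻¹ * b) ≤ wordLength S (b⁻¹ * a) := fun a b => by
      simpa using wordLength_inv_le hS (b⁻¹ * a)
    exact_mod_cast le_antisymm (key g h) (key h g)
  dist_triangle a b c := by
    have := wordLength_mul_le hS (a⁻¹ * b) (b⁻¹ * c)
    rw [mul_assoc, mul_inv_cancel_left] at this
    exact_mod_cast this
  eq_of_dist_eq_zero {g h} H := by
    have H' : wordLength S (g⁻¹ * h) = 0 := by exact_mod_cast H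
    obtain ⟨l, h1, -, h3⟩ := exists_word hS (g⁻¹ * h)
    rw [H', List.length_eq_zero_iff] at h1
    rw [h1, List.prod_nil] at h3
    exact inv_mul_eq_one.1 h3.symm

/-- The group `G`, endowed with the word metric of the generating set `S`. -/
def WordSpace {G : Type*} [Group G] (S : Set G) (_hS : Subgroup.closure S = ⊤) : Type _ := G

instance {G : Type*} [Group G] (S : Set G) (hS : Subgroup.closure S = ⊤) :
    MetricSpace (WordSpace S hS) :=
  wordMetric (G := G) S hS

end WordMetric

/-! ### Graph products -/

section GraphProducts

open scoped commutatorElement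

/-- The commutators `[g, h]` with `g ∈ G_u`, `h ∈ G_v` and `{u, v}` an edge of `Γ`. -/
def commutatorRelators {V : Type*} (Γ : SimpleGraph V) (G : V → Type*) [∀ u, Group (G u)] :
    Set (Monoid.CoprodI G) :=
  {w | ∃ (u v : V) (g : G u) (h : G v), Γ.Adj u v ∧
    w = ⁅Monoid.CoprodI.of g, Monoid.CoprodI.of h⁆}

/-- The graph product `Γ𝒢`: the free product of the vertex-groups modulo the normal closure of the
commutators of elements of adjacent vertex-groups. -/
def GraphProduct {V : Type*} (Γ : SimpleGraph V) (G : V → Type*) [∀ u, Group (G u)] : Type _ :=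
  Monoid.CoprodI G ⧸ Subgroup.normalClosure (commutatorRelators Γ G)

instance {V : Type*} (Γ : SimpleGraph V) (G : V → Type*) [∀ u, Group (G u)] :
    Group (GraphProduct Γ G) :=
  inferInstanceAs (Group (Monoid.CoprodI G ⧸ Subgroup.normalClosure (commutatorRelators Γ G)))

/-- The quotient morphism from the free product of the vertex-groups to the graph product. -/
def quotientHom {V : Type*} (Γ : SimpleGraph V) (G : V → Type*) [∀ u, Group (G u)] :
    Monoid.CoprodI G →* GraphProduct Γ G :=
  QuotientGroup.mk' (Subgroup.normalClosure (commutatorRelators Γ G))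

/-- The canonical morphism from a vertex-group to the graph product. -/
def vertexHom {V : Type*} (Γ : SimpleGraph V) (G : V → Type*) [∀ u, Group (G u)] (u : V) :
    G u →* GraphProduct Γ G :=
  (quotientHom Γ G).comp Monoid.CoprodI.of

/-- The subgroup `⟨Λ⟩` generated by the vertex-groups indexed by the vertices in `Λ`. -/
def spanSubgroup {V : Type*} (Γ : SimpleGraph V) (G : V → Type*) [∀ u, Group (G u)]
    (Λ : Set V) : Subgroup (GraphProduct Γ G) :=
  ⨆ u ∈ Λ, (vertexHom Γ G u).range

/-- The family of all (left) cosets of clique-subgroups, i.e. of the subgroups `⟨Λ⟩` where `Λ` is a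
(possibly empty) clique of `Γ`. -/
def cliqueCosets {V : Type*} (Γ : SimpleGraph V) (G : V → Type*) [∀ u, Group (G u)] :
    Set (Set (GraphProduct Γ G)) :=
  {A | ∃ (Λ : Set V) (g : GraphProduct Γ G), Γ.IsClique Λ ∧
    A = (fun h => g * h) '' (spanSubgroup Γ G Λ : Set (GraphProduct Γ G))}

/-- The right-angled Artin group `A(Γ)`: the graph product of infinite cyclic groups. -/
abbrev RAAG {V : Type*} (Γ : SimpleGraph V) : Type _ :=
  GraphProduct Γ (fun _ : V => Multiplicative ℤ)

end GraphProducts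

/-! ### Hyperbolic 3-space -/

section Hyperbolic

/-- Real hyperbolic 3-space, in the upper half-space model `{p ∈ ℝ³ | p₂ > 0}`. -/
structure Hyperbolic3 where
  /-- the underlying point of Euclidean 3-space -/
  pt : EuclideanSpace ℝ (Fin 3)
  /-- the height is positive -/
  pos : 0 < pt 2

namespace Hyperbolic3

/-- The hyperbolic distance `d(p, q) = 2 arsinh (|p - q| / (2 √(p₂ q₂)))`. -/
instance : Dist Hyperbolic3 :=
  ⟨fun p q => 2 * Real.arsinh (dist p.pt q.pt / (2 * √(p.pt 2 * q.pt 2)))⟩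

theorem dist_eq (p q : Hyperbolic3) :
    dist p q = 2 * Real.arsinh (dist p.pt q.pt / (2 * √(p.pt 2 * q.pt 2))) := rfl

/-- Reflection in the boundary plane. -/
def conj (v : EuclideanSpace ℝ (Fin 3)) : EuclideanSpace ℝ (Fin 3) := !₂[v 0, v 1, -v 2]

theorem sinh_half_dist (p q : Hyperbolic3) :
    Real.sinh (dist p q / 2) = dist p.pt q.pt / (2 * √(p.pt 2 * q.pt 2)) := by
  rw [dist_eq, mul_div_cancel_left₀ _ two_ne_zero, Real.sinh_arsinh]

theorem dist_conj_sq (v w : EuclideanSpace ℝ (Fin 3)) :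
    dist v (conj w) ^ 2 = dist v w ^ 2 + 4 * (v 2 * w 2) := by
  rw [EuclideanSpace.dist_sq_eq, EuclideanSpace.dist_sq_eq]
  simp only [Fin.sum_univ_three, Real.dist_eq, sq_abs, conj]
  simp
  ring

theorem cosh_half_dist (p q : Hyperbolic3) :
    Real.cosh (dist p q / 2) = dist p.pt (conj q.pt) / (2 * √(p.pt 2 * q.pt 2)) := by
  have h := mul_pos p.pos q.pos
  have hs : 0 < √(p.pt 2 * q.pt 2) := Real.sqrt_pos.2 h
  rw [← sq_eq_sq₀ (Real.cosh_pos _).le (by positivity), Real.cosh_sq', sinh_half_dist, div_pow,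
    div_pow, dist_conj_sq, mul_pow, Real.sq_sqrt h.le]
  have h1 := p.pos.ne'
  have h2 := q.pos.ne'
  field_simp
  ring

theorem dist_conj_comm (v w : EuclideanSpace ℝ (Fin 3)) : dist v (conj w) = dist w (conj v) := by
  rw [← sq_eq_sq₀ dist_nonneg dist_nonneg, dist_conj_sq, dist_conj_sq, dist_comm v w,
    mul_comm (v 2)]

theorem dist_self_conj (q : Hyperbolic3) : dist q.pt (conj q.pt) = 2 * q.pt 2 := by
  have := q.pos
  rw [← sq_eq_sq₀ dist_nonneg (by positivity), dist_conj_sq, dist_self]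
  ring

protected theorem dist_triangle (a b c : Hyperbolic3) : dist a c ≤ dist a b + dist b c := by
  have ha := a.pos
  have hb := b.pos
  have hc := c.pos
  have key := EuclideanGeometry.mul_dist_le_mul_dist_add_mul_dist a.pt b.pt c.pt (conj b.pt)
  suffices h : Real.sinh (dist a c / 2) ≤ Real.sinh (dist a b / 2 + dist b c / 2) by
    have := Real.sinh_le_sinh.1 h
    linarith
  rw [Real.sinh_add, sinh_half_dist, sinh_half_dist, sinh_half_dist, cosh_half_dist,
    cosh_half_dist, Real.sqrt_mul ha.le, Real.sqrt_mul ha.le, Real.sqrt_mul hb.le]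
  rw [dist_self_conj, dist_conj_comm a.pt] at key
  rw [dist_conj_comm a.pt, dist_conj_comm b.pt c.pt]
  have hx : 0 < √(a.pt 2) := Real.sqrt_pos.2 ha
  have hy : 0 < √(b.pt 2) := Real.sqrt_pos.2 hb
  have hz : 0 < √(c.pt 2) := Real.sqrt_pos.2 hc
  have hyy : √(b.pt 2) ^ 2 = b.pt 2 := Real.sq_sqrt hb.le
  rw [← hyy] at key
  field_simp
  nlinarith [key]

instance : MetricSpace Hyperbolic3 where
  dist := dist
  dist_self p := by rw [dist_eq, dist_self, zero_div, Real.arsinh_zero, mul_zero]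
  dist_comm p q := by rw [dist_eq, dist_eq, dist_comm p.pt, mul_comm (p.pt 2)]
  dist_triangle := Hyperbolic3.dist_triangle
  eq_of_dist_eq_zero {p q} h := by
    have hs : √(p.pt 2 * q.pt 2) ≠ 0 := (Real.sqrt_pos.2 (mul_pos p.pos q.pos)).ne'
    rw [dist_eq] at h
    have h' : p.pt = q.pt := by simpa [hs] using h
    cases p
    cases q
    simpa using h'

end Hyperbolic3

end Hyperbolic

end ChordalCoarse

end

/-! The dichotomy holds for every subset `Y` of the graph product, connected or not, and every scale
`k`. It is proved by induction on `Λ`, for `Y` in a neighbourhood of a coset of `⟨Λ⟩`. By Dirac's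
theorem some `v ∈ Λ` has a clique `N` as its link in `Λ`, and `⟨Λ⟩` is the amalgam of `⟨Λ ∖ v⟩` and
`⟨N ∪ v⟩` over `⟨N⟩`. Each edge of the Bass–Serre tree is a coset of the clique-subgroup `⟨N⟩` and
cuts `⟨Λ⟩` into two sides. If `Y` is not coarsely separated by cosets of clique-subgroups, then for
each edge one of the two parts of `Y` stays uniformly close to that edge
(`exists_side_near_of_not_separatedAt`). Following the edges that have points of `Y` far beyond them
leads to a vertex of the tree near which all of `Y` lies. This vertex is a coset of `⟨N ∪ v⟩`, a
clique-subgroup, or of `⟨Λ ∖ v⟩`, where the induction continues (`near_or_near_of_not_separatedAt`).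

The tree itself is not built. The homomorphism `splitting` records the `G v`-letters of an element
as a reduced word in a free product of copies of `G v` indexed by the cosets of `⟨link v⟩`.
Half-trees become conditions on suffixes of the list `syllables`.

In a right-angled Artin group the abelianization embeds clique-subgroups in free abelian groups of
rank at most the clique number, so their cosets have growth `O(r^clique)`. A coarse embedding pulls
this growth back to `X`. In the first case of the dichotomy all subsets of `X` then have this
growth, and spheres separate `X`; in the second case the preimages of neighbourhoods of the cosets
separate `X`.

For hyperbolic space, families of polynomial growth are shown neither to be coarsely dense nor to
separate coarsely. Seen from a point `x`, a point `p` of the family at distance `d` blocks a set of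
coordinates of measure at most a multiple of `exp (-d)` times the height of `x`. A series of
polynomial times exponential terms converges, so most vertical lines below a point far from the
family avoid it, and two such points are joined near the boundary plane. -/

noncomputable section

namespace ChordalCoarse

/-! ### Dirac's theorem on simplicial vertices -/

section SimplicialVertices

/-- There is a path of length `n` from `s` to `t` whose interior vertices lie in `A`. -/
def HasPathThrough {V : Type*} (Γ : SimpleGraph V) (A : Set V) (s t : V) (n : ℕ) : Prop :=
  ∃ p : ℕ → V, p 0 = s ∧ p n = t ∧ (∀ i, 0 < i → i < n → p i ∈ A) ∧
    ∀ i < n, Γ.Adj (p i) (p (i + 1))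

theorem exists_seq_of_reflTransGen {V : Type*} {r : V → V → Prop} {a b : V}
    (h : Relation.ReflTransGen r a b) :
    ∃ (n : ℕ) (p : ℕ → V), p 0 = a ∧ p n = b ∧ ∀ i < n, r (p i) (p (i + 1)) := by
  induction h with
  | refl => exact ⟨0, fun _ => a, rfl, rfl, by simp⟩
  | @tail b c _ hbc ih =>
    obtain ⟨n, p, h0, hn, hp⟩ := ih
    refine ⟨n + 1, fun i => if i ≤ n then p i else c, by simpa using h0, by simp, ?_⟩
    intro i hi
    rcases Nat.lt_succ_iff_lt_or_eq.1 hi with h | h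
    · have h1 : i ≤ n := h.le
      have h2 : i + 1 ≤ n := h
      simpa [h1, h2] using hp i h
    · subst h
      simpa [hn] using hbc

theorem cycleGraph_adj_iff_val {n : ℕ} (hn : 1 ≤ n) (u v : Fin (n + 2)) :
    (SimpleGraph.cycleGraph (n + 2)).Adj u v ↔
      (u.val + 1 = v.val ∨ v.val + 1 = u.val ∨ (u.val = 0 ∧ v.val = n + 1) ∨
        (v.val = 0 ∧ u.val = n + 1)) := by
  rw [SimpleGraph.cycleGraph_adj']
  have hu := u.isLt
  have hv := v.isLt
  rcases lt_trichotomy u v with h | h | h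
  · have h1 := Fin.coe_sub_iff_lt.2 h
    have h2 := Fin.coe_sub_iff_le.2 h.le
    have h3 : u.val < v.val := h
    omega
  · subst h
    have h1 := Fin.coe_sub_iff_le.2 (le_refl u)
    omega
  · have h1 := Fin.coe_sub_iff_lt.2 h
    have h2 := Fin.coe_sub_iff_le.2 h.le
    have h3 : v.val < u.val := h
    omega

/-- In a chordal graph, two distinct vertices that are joined by a path through `A` and have a
common neighbour outside `A` with no neighbour in `A` are adjacent. -/
theorem IsChordal.adj_of_hasPathThrough {V : Type*} {Γ : SimpleGraph V} (hΓ : IsChordal Γ)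
    {A : Set V} {s t b : V} {n : ℕ} (hp : HasPathThrough Γ A s t n) (hst : s ≠ t)
    (hbA : b ∉ A) (hb : ∀ a ∈ A, ¬ Γ.Adj b a)
    (hbs : Γ.Adj b s) (hbt : Γ.Adj b t) : Γ.Adj s t := by
  classical
  by_contra hadj
  have hex : ∃ n, HasPathThrough Γ A s t n := ⟨n, hp⟩
  -- A shortest path through `A` has no repeated vertex and no chord. Together with `b` it will form
  -- an induced cycle of length `m + 2`, which is at least 4 because `s` and `t` are supposed
  -- distinct and non-adjacent.
  obtain ⟨m, ⟨p, p0, pm, pA, padj⟩, hmin⟩ : ∃ m, HasPathThrough Γ A s t m ∧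
      ∀ m' < m, ¬ HasPathThrough Γ A s t m' :=
    ⟨Nat.find hex, Nat.find_spec hex, fun m' h => Nat.find_min hex h⟩
  have hm2 : 2 ≤ m := by
    by_contra h
    have : m = 0 ∨ m = 1 := by omega
    rcases this with rfl | rfl
    · exact hst (p0.symm.trans pm)
    · have := padj 0 (by omega)
      rw [p0, zero_add, pm] at this
      exact hadj this
  -- a shortcut over the indices strictly between `i` and `i + d + 1`
  have shortcut : ∀ i d, i + d ≤ m → 0 < d →
      (∀ q : ℕ → V, q = (fun k => if k ≤ i then p k else p (k + d)) →
        i < m - d → Γ.Adj (q i) (q (i + 1))) →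
      (i = m - d → p i = p m) → False := by
    intro i d hid hd hq hend
    refine hmin (m - d) (by omega) ⟨fun k => if k ≤ i then p k else p (k + d), by simpa using p0,
      ?_, ?_, ?_⟩
    · by_cases h : m - d ≤ i
      · have : i = m - d := by omega
        simp only [h, if_true]
        rw [← this, hend this, pm]
      · simp only [h, if_false]
        rw [Nat.sub_add_cancel (by omega), pm]
    · intro k hk1 hk2
      by_cases h : k ≤ i
      · simpa [h] using pA k hk1 (by omega)
      · simpa [h] using pA (k + d) (by omega) (by omega)
    · intro k hk
      rcases lt_trichotomy k i with h | h | h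
      · have h1 : k ≤ i := h.le
        have h2 : k + 1 ≤ i := h
        simpa [h1, h2] using padj k (by omega)
      · subst h
        exact hq _ rfl hk
      · have h1 : ¬ k ≤ i := by omega
        have h2 : ¬ k + 1 ≤ i := by omega
        have h3 : k + 1 + d = k + d + 1 := by omega
        simpa [h1, h2, h3] using padj (k + d) (by omega)
  have pinj : ∀ i j, i < j → j ≤ m → p i ≠ p j := by
    intro i j hij hj he
    refine shortcut i (j - i) (by omega) (by omega) ?_ ?_
    · rintro q rfl hlt
      have h1 : i + 1 + (j - i) = j + 1 := by omega
      simp only [le_refl, if_true, show ¬ i + 1 ≤ i by omega, if_false, h1, he]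
      exact padj j (by omega)
    · intro h
      rw [he]
      congr 1
      omega
  have pind : ∀ i j, i < j → j ≤ m → Γ.Adj (p i) (p j) → j = i + 1 := by
    intro i j hij hj he
    by_contra hne
    refine shortcut i (j - i - 1) (by omega) (by omega) ?_ ?_
    · rintro q rfl hlt
      have h1 : i + 1 + (j - i - 1) = j := by omega
      simpa only [le_refl, if_true, show ¬ i + 1 ≤ i by omega, if_false, h1] using he
    · intro h
      omega
  have pne : ∀ i ≤ m, p i ≠ b := by
    intro i hi he
    rcases Nat.eq_zero_or_pos i with rfl | h0
    · rw [p0] at he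
      exact hbs.ne he.symm
    rcases hi.lt_or_eq with h | rfl
    · exact hbA (he ▸ pA i h0 h)
    · rw [pm] at he
      exact hbt.ne he.symm
  have pb : ∀ i ≤ m, (Γ.Adj (p i) b ↔ i = 0 ∨ i = m) := by
    intro i hi
    constructor
    · intro h
      by_contra hne
      push Not at hne
      exact hb _ (pA i (by omega) (by omega)) h.symm
    · rintro (rfl | rfl)
      · rw [p0]; exact hbs.symm
      · rw [pm]; exact hbt.symm
  have padj' : ∀ i j, i ≤ m → j ≤ m → (Γ.Adj (p i) (p j) ↔ i + 1 = j ∨ j + 1 = i) := by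
    intro i j hi hj
    constructor
    · intro h
      rcases lt_trichotomy i j with h1 | h1 | h1
      · exact Or.inl (pind i j h1 hj h).symm
      · subst h1
        exact (h.ne rfl).elim
      · exact Or.inr (pind j i h1 hi h.symm).symm
    · rintro (rfl | rfl)
      · exact padj i hj
      · exact (padj j hi).symm
  -- The index `m + 1` carries `b`, which closes the cycle between `p m` and `p 0`.
  let f : Fin (m + 2) → V := fun k => if k.val ≤ m then p k.val else b
  have f1 : ∀ k : Fin (m + 2), k.val ≤ m → f k = p k.val := fun k hk => if_pos hk
  have f2 : ∀ k : Fin (m + 2), ¬ k.val ≤ m → f k = b := fun k hk => if_neg hk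
  have finj : Function.Injective f := by
    intro i j hij
    have hi := i.isLt
    have hj := j.isLt
    apply Fin.ext
    by_cases h1 : i.val ≤ m <;> by_cases h2 : j.val ≤ m
    · rw [f1 i h1, f1 j h2] at hij
      rcases lt_trichotomy i.val j.val with h | h | h
      · exact (pinj _ _ h h2 hij).elim
      · exact h
      · exact (pinj _ _ h h1 hij.symm).elim
    · rw [f1 i h1, f2 j h2] at hij
      exact (pne _ h1 hij).elim
    · rw [f2 i h1, f1 j h2] at hij
      exact (pne _ h2 hij.symm).elim
    · omega
  refine (hΓ (m + 2) (by omega)).false ⟨⟨f, finj⟩, ?_⟩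
  intro i j
  have hi := i.isLt
  have hj := j.isLt
  rw [cycleGraph_adj_iff_val (by omega)]
  change Γ.Adj (f i) (f j) ↔ _
  by_cases h1 : i.val ≤ m <;> by_cases h2 : j.val ≤ m
  · rw [f1 i h1, f1 j h2, padj' _ _ h1 h2]
    omega
  · rw [f1 i h1, f2 j h2, pb _ h1]
    omega
  · rw [f2 i h1, f1 j h2, Γ.adj_comm, pb _ h2]
    omega
  · rw [f2 i h1, f2 j h2]
    have := Γ.irrefl (v := b)
    simp only [this, false_iff]
    omega

/-- **Dirac's theorem**: every nonempty finite set of vertices of a chordal graph contains a vertex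
that is simplicial in the subgraph it induces. -/
theorem IsChordal.exists_simplicial {V : Type*} [Finite V] {Γ : SimpleGraph V} (hΓ : IsChordal Γ)
    (Λ : Set V) (hΛ : Λ.Nonempty) : ∃ v ∈ Λ, Γ.IsClique (Λ ∩ Γ.neighborSet v) := by
  classical
  induction hn : Λ.ncard using Nat.strong_induction_on generalizing Λ with
  | _ n ih =>
  by_cases hcl : Γ.IsClique Λ
  · obtain ⟨v, hv⟩ := hΛ
    exact ⟨v, hv, hcl.subset Set.inter_subset_left⟩
  let r : Set V → V → V → Prop := fun A x y => Γ.Adj x y ∧ x ∈ A ∧ y ∈ A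
  let far : Set V → Set V := fun A => {b | b ∈ Λ ∧ b ∉ A ∧ ∀ a ∈ A, ¬ Γ.Adj b a}
  let good : Set V → Prop := fun A => A ⊆ Λ ∧ A.Nonempty ∧
    (∀ x ∈ A, ∀ y ∈ A, Relation.ReflTransGen (r A) x y) ∧ (far A).Nonempty
  obtain ⟨A0, hA0⟩ : ∃ A, good A := by
    simp only [SimpleGraph.IsClique, Set.Pairwise] at hcl
    push Not at hcl
    obtain ⟨x, hx, y, hy, hxy, hadj⟩ := hcl
    refine ⟨{x}, by simpa using hx, ⟨x, rfl⟩, ?_, y, hy, by simpa using hxy.symm, ?_⟩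
    · rintro a rfl b rfl
      exact Relation.ReflTransGen.refl
    · rintro a rfl h
      exact hadj h.symm
  -- Among the connected subsets of `Λ` that do not dominate `Λ`, take a maximal one. Its outer
  -- boundary `T` separates it from `far A`.
  obtain ⟨A, -, hA⟩ := (Set.toFinite {A | good A}).exists_le_maximal hA0
  obtain ⟨⟨hAΛ, hAne, hAconn, hfar⟩, hmax⟩ := hA
  let T : Set V := {t | t ∈ Λ ∧ t ∉ A ∧ ∃ a ∈ A, Γ.Adj t a}
  -- If `t` missed some `b` in `far A`, then `insert t A` would still be connected and still leave
  -- `b` far, against maximality.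
  have hTfar : ∀ t ∈ T, ∀ b ∈ far A, Γ.Adj t b := by
    rintro t ⟨htΛ, htA, a, haA, hta⟩ b ⟨hbΛ, hbA, hb⟩
    by_contra hadj
    have htt : t ∈ insert t A := Set.mem_insert _ _
    have hmono : ∀ x y, Relation.ReflTransGen (r A) x y →
        Relation.ReflTransGen (r (insert t A)) x y := fun x y h =>
      Relation.ReflTransGen.mono (show r A ≤ r (insert t A) from fun x y hxy => ⟨hxy.1, Set.mem_insert_of_mem _ hxy.2.1,
        Set.mem_insert_of_mem _ hxy.2.2⟩) x y h
    have hat : a ∈ insert t A := Set.mem_insert_of_mem _ haA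
    have hgood : good (insert t A) := by
      refine ⟨Set.insert_subset htΛ hAΛ, ⟨t, htt⟩, ?_, b, hbΛ, ?_, ?_⟩
      · rintro x (rfl | hx) y (rfl | hy)
        · exact Relation.ReflTransGen.refl
        · exact Relation.ReflTransGen.head ⟨hta, htt, hat⟩ (hmono _ _ (hAconn a haA y hy))
        · exact Relation.ReflTransGen.tail (hmono _ _ (hAconn x hx a haA)) ⟨hta.symm, hat, htt⟩
        · exact hmono _ _ (hAconn x hx y hy)
      · rintro (rfl | h)
        · exact hb a haA hta
        · exact hbA h
      · rintro c (rfl | hc) h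
        · exact hadj h.symm
        · exact hb c hc h
    exact htA (hmax hgood (Set.subset_insert _ _) htt)
  -- Two vertices of `T` are joined through the connected set `A` and have a common neighbour in
  -- `far A`, so chordality makes them adjacent.
  have hTclique : Γ.IsClique T := by
    intro s hs t ht hst
    obtain ⟨b, hb⟩ := hfar
    obtain ⟨a, ha, hsa⟩ := hs.2.2
    obtain ⟨c, hc, htc⟩ := ht.2.2
    obtain ⟨n, p, p0, pn, hp⟩ := exists_seq_of_reflTransGen (hAconn a ha c hc)
    have hpA : ∀ i ≤ n, p i ∈ A := by
      intro i hi
      rcases hi.lt_or_eq with h | rfl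
      · exact (hp i h).2.1
      · exact pn ▸ hc
    refine hΓ.adj_of_hasPathThrough (A := A) (b := b) (n := n + 2)
      ⟨fun k => if k = 0 then s else if k ≤ n + 1 then p (k - 1) else t, by simp, by simp, ?_, ?_⟩
      hst hb.2.1 hb.2.2 (hTfar s hs b hb).symm (hTfar t ht b hb).symm
    · intro i h1 h2
      simp only [show i ≠ 0 by omega, if_false, show i ≤ n + 1 by omega, if_true]
      exact hpA _ (by omega)
    · intro i hi
      rcases Nat.eq_zero_or_pos i with rfl | h0
      · simpa [p0] using hsa
      rcases (Nat.lt_succ_iff.1 hi).lt_or_eq with h | rfl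
      · have h1 : i ≤ n + 1 := by omega
        have h2 : i - 1 + 1 = i := by omega
        simp only [show i ≠ 0 by omega, if_false, h1, if_true, show i + 1 ≠ 0 by omega,
          show i + 1 ≤ n + 1 by omega, Nat.add_sub_cancel]
        have := (hp (i - 1) (by omega)).1
        rwa [h2] at this
      · simpa [pn] using htc.symm
  have hlt : (far A).ncard < n := by
    rw [← hn]
    refine Set.ncard_lt_ncard ⟨fun x hx => hx.1, fun h => ?_⟩ (Set.toFinite _)
    obtain ⟨a, ha⟩ := hAne
    exact (h (hAΛ ha)).2.1 ha
  obtain ⟨v, hv, hvcl⟩ := ih _ hlt (far A) hfar rfl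
  refine ⟨v, hv.1, ?_⟩
  -- A vertex that is simplicial in `far A` stays so in `Λ`: its new neighbours lie in `T`, a clique
  -- completely joined to `far A`.
  have hsub : ∀ x ∈ Λ ∩ Γ.neighborSet v, x ∈ T ∨ x ∈ far A ∩ Γ.neighborSet v := by
    rintro x ⟨hxΛ, hvx⟩
    have hxA : x ∉ A := fun h => hv.2.2 x h hvx
    by_cases h : ∃ a ∈ A, Γ.Adj x a
    · exact Or.inl ⟨hxΛ, hxA, h⟩
    · push Not at h
      exact Or.inr ⟨⟨hxΛ, hxA, h⟩, hvx⟩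
  intro x hx y hy hxy
  rcases hsub x hx with h1 | h1 <;> rcases hsub y hy with h2 | h2
  · exact hTclique h1 h2 hxy
  · exact hTfar x h1 y h2.1
  · exact (hTfar y h2 x h1.1).symm
  · exact hvcl h1 h2 hxy

end SimplicialVertices

/-! ### Algebra of graph products -/

section GraphProductAlgebra

open Monoid (CoprodI)
open scoped commutatorElement

variable {V : Type*} {Γ : SimpleGraph V} {G : V → Type*} [∀ u, Group (G u)]

theorem commute_vertexHom {u w : V} (huw : Γ.Adj u w) (a : G u) (b : G w) :
    Commute (vertexHom Γ G u a) (vertexHom Γ G w b) := by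
  rw [← commutatorElement_eq_one_iff_commute]
  change ⁅quotientHom Γ G (CoprodI.of a), quotientHom Γ G (CoprodI.of b)⁆ = 1
  rw [← map_commutatorElement]
  exact (QuotientGroup.eq_one_iff _).2 (Subgroup.subset_normalClosure ⟨u, w, a, b, huw, rfl⟩)

/-- The universal property of graph products. -/
def GraphProduct.lift {H : Type*} [Group H] (f : ∀ u, G u →* H)
    (hf : ∀ u w, Γ.Adj u w → ∀ a b, Commute (f u a) (f w b)) : GraphProduct Γ G →* H :=
  QuotientGroup.lift _ (CoprodI.lift f) <| by
    refine Subgroup.normalClosure_le_normal (N := (CoprodI.lift f).ker) ?_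
    rintro _ ⟨u, w, a, b, huw, rfl⟩
    rw [SetLike.mem_coe, MonoidHom.mem_ker, map_commutatorElement, CoprodI.lift_of,
      CoprodI.lift_of]
    exact commutatorElement_eq_one_iff_commute.2 (hf u w huw a b)

theorem GraphProduct.lift_vertexHom {H : Type*} [Group H] (f : ∀ u, G u →* H)
    (hf : ∀ u w, Γ.Adj u w → ∀ a b, Commute (f u a) (f w b)) (u : V) (a : G u) :
    GraphProduct.lift f hf (vertexHom Γ G u a) = f u a :=
  (QuotientGroup.lift_mk' _ _ _).trans (CoprodI.lift_of _ _)

theorem GraphProduct.hom_ext {H : Type*} [Group H] {f g : GraphProduct Γ G →* H}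
    (h : ∀ u a, f (vertexHom Γ G u a) = g (vertexHom Γ G u a)) : f = g := by
  refine QuotientGroup.monoidHom_ext _ (CoprodI.ext_hom _ _ fun u => MonoidHom.ext fun a => ?_)
  exact h u a

theorem vertexHom_mem_spanSubgroup {Λ : Set V} {u : V} (hu : u ∈ Λ) (a : G u) :
    vertexHom Γ G u a ∈ spanSubgroup Γ G Λ :=
  (le_iSup₂ (f := fun u (_ : u ∈ Λ) => (vertexHom Γ G u).range) u hu) ⟨a, rfl⟩

theorem spanSubgroup_le {Λ : Set V} {H : Subgroup (GraphProduct Γ G)}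
    (h : ∀ u ∈ Λ, ∀ a, vertexHom Γ G u a ∈ H) : spanSubgroup Γ G Λ ≤ H := by
  refine iSup₂_le fun u hu => ?_
  rintro _ ⟨a, rfl⟩
  exact h u hu a

theorem spanSubgroup_mono {Λ Λ' : Set V} (h : Λ ⊆ Λ') :
    spanSubgroup Γ G Λ ≤ spanSubgroup Γ G Λ' :=
  spanSubgroup_le fun _ hu a => vertexHom_mem_spanSubgroup (h hu) a

theorem spanSubgroup_univ : spanSubgroup Γ G Set.univ = ⊤ := by
  rw [eq_top_iff]
  intro g _
  obtain ⟨w, rfl⟩ : ∃ w, quotientHom Γ G w = g := QuotientGroup.mk'_surjective _ g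
  induction w using CoprodI.induction_on with
  | one => rw [map_one]; exact one_mem _
  | of u a => exact vertexHom_mem_spanSubgroup (Set.mem_univ u) a
  | mul x y hx hy =>
    rw [map_mul]
    exact mul_mem (hx trivial) (hy trivial)

theorem spanSubgroup_induction {Λ : Set V} {p : GraphProduct Γ G → Prop}
    (vertex : ∀ u ∈ Λ, ∀ a, p (vertexHom Γ G u a)) (one : p 1)
    (mul : ∀ g h, g ∈ spanSubgroup Γ G Λ → h ∈ spanSubgroup Γ G Λ → p g → p h → p (g * h))
    (inv : ∀ g, g ∈ spanSubgroup Γ G Λ → p g → p g⁻¹)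
    {g : GraphProduct Γ G} (hg : g ∈ spanSubgroup Γ G Λ) : p g := by
  let H : Subgroup (GraphProduct Γ G) :=
    { carrier := {g | g ∈ spanSubgroup Γ G Λ ∧ p g}
      one_mem' := ⟨one_mem _, one⟩
      mul_mem' := fun ha hb => ⟨mul_mem ha.1 hb.1, mul _ _ ha.1 hb.1 ha.2 hb.2⟩
      inv_mem' := fun ha => ⟨inv_mem ha.1, inv _ ha.1 ha.2⟩ }
  have : spanSubgroup Γ G Λ ≤ H :=
    spanSubgroup_le fun u hu a => ⟨vertexHom_mem_spanSubgroup hu a, vertex u hu a⟩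
  exact (this hg).2

open Classical in
/-- The retraction of a graph product onto `⟨Λ⟩` that kills the other vertex-groups. -/
def retraction (Γ : SimpleGraph V) (G : V → Type*) [∀ u, Group (G u)] (Λ : Set V) :
    GraphProduct Γ G →* GraphProduct Γ G :=
  GraphProduct.lift (fun u => if u ∈ Λ then vertexHom Γ G u else 1) <| by
    intro u w huw a b
    by_cases hu : u ∈ Λ <;> by_cases hw : w ∈ Λ <;> simp [hu, hw, commute_vertexHom huw]

theorem retraction_vertexHom_of_mem {Λ : Set V} {u : V} (hu : u ∈ Λ) (a : G u) :
    retraction Γ G Λ (vertexHom Γ G u a) = vertexHom Γ G u a := by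
  simp [retraction, GraphProduct.lift_vertexHom, hu]

theorem retraction_vertexHom_of_notMem {Λ : Set V} {u : V} (hu : u ∉ Λ) (a : G u) :
    retraction Γ G Λ (vertexHom Γ G u a) = 1 := by
  simp [retraction, GraphProduct.lift_vertexHom, hu]

theorem retraction_eq_self {Λ : Set V} {g : GraphProduct Γ G} (hg : g ∈ spanSubgroup Γ G Λ) :
    retraction Γ G Λ g = g := by
  refine spanSubgroup_induction (p := fun g => retraction Γ G Λ g = g) ?_ ?_ ?_ ?_ hg
  · exact fun u hu a => retraction_vertexHom_of_mem hu a
  · exact map_one _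
  · intro g h _ _ h1 h2
    rw [map_mul, h1, h2]
  · intro g _ h
    rw [map_inv, h]

theorem retraction_mem {Λ Λ' : Set V} {g : GraphProduct Γ G} (hg : g ∈ spanSubgroup Γ G Λ') :
    retraction Γ G Λ g ∈ spanSubgroup Γ G (Λ' ∩ Λ) := by
  have : spanSubgroup Γ G Λ' ≤ (spanSubgroup Γ G (Λ' ∩ Λ)).comap (retraction Γ G Λ) := by
    refine spanSubgroup_le fun u hu a => ?_
    rw [Subgroup.mem_comap]
    by_cases h : u ∈ Λ
    · rw [retraction_vertexHom_of_mem h]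
      exact vertexHom_mem_spanSubgroup (show u ∈ Λ' ∩ Λ from ⟨hu, h⟩) a
    · rw [retraction_vertexHom_of_notMem h]
      exact one_mem _
  exact this hg

/-- The retraction onto `⟨Λ'⟩` fixes `g` and maps `⟨Λ⟩` into `⟨Λ ∩ Λ'⟩`. -/
theorem mem_spanSubgroup_inter {Λ Λ' : Set V} {g : GraphProduct Γ G}
    (h : g ∈ spanSubgroup Γ G Λ) (h' : g ∈ spanSubgroup Γ G Λ') :
    g ∈ spanSubgroup Γ G (Λ ∩ Λ') := by
  rw [← retraction_eq_self h']
  exact retraction_mem h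

/-! #### The splitting over the link of a vertex -/

/-- The cosets of the subgroup generated by the link of `v`. -/
abbrev LinkCosets (Γ : SimpleGraph V) (G : V → Type*) [∀ u, Group (G u)] (v : V) : Type _ :=
  GraphProduct Γ G ⧸ spanSubgroup Γ G (Γ.neighborSet v)

/-- The free product of copies of `G v` indexed by the cosets of `⟨link v⟩`. -/
abbrev LinkCoprod (Γ : SimpleGraph V) (G : V → Type*) [∀ u, Group (G u)] (v : V) : Type _ :=
  CoprodI (fun _ : LinkCosets Γ G v => G v)

/-- The element `a` in the factor indexed by `c`. -/
def LinkCoprod.of {v : V} (c : LinkCosets Γ G v) : G v →* LinkCoprod Γ G v :=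
  CoprodI.of (M := fun _ : LinkCosets Γ G v => G v) (i := c)

theorem LinkCoprod.hom_ext {v : V} {H : Type*} [Group H] {f g : LinkCoprod Γ G v →* H}
    (h : ∀ c a, f (LinkCoprod.of c a) = g (LinkCoprod.of c a)) : f = g :=
  CoprodI.ext_hom _ _ fun c => MonoidHom.ext fun a => h c a

/-- The graph product permutes the free factors. -/
def LinkCoprod.permute (v : V) (g : GraphProduct Γ G) : LinkCoprod Γ G v →* LinkCoprod Γ G v :=
  CoprodI.lift fun c => LinkCoprod.of (g • c)

theorem LinkCoprod.permute_of {v : V} (g : GraphProduct Γ G) (c : LinkCosets Γ G v) (a : G v) :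
    LinkCoprod.permute v g (LinkCoprod.of c a) = LinkCoprod.of (g • c) a :=
  CoprodI.lift_of _ _

theorem LinkCoprod.permute_one (v : V) :
    LinkCoprod.permute v (1 : GraphProduct Γ G) = MonoidHom.id _ :=
  LinkCoprod.hom_ext fun c a => by rw [permute_of, one_smul, MonoidHom.id_apply]

theorem LinkCoprod.permute_comp (v : V) (g h : GraphProduct Γ G) :
    (LinkCoprod.permute v g).comp (LinkCoprod.permute v h) = LinkCoprod.permute v (g * h) :=
  LinkCoprod.hom_ext fun c a => by
    rw [MonoidHom.comp_apply, permute_of, permute_of, permute_of, mul_smul]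

/-- The action of the graph product on the free product by permutation of the factors. -/
def LinkCoprod.aut (Γ : SimpleGraph V) (G : V → Type*) [∀ u, Group (G u)] (v : V) :
    GraphProduct Γ G →* MulAut (LinkCoprod Γ G v) where
  toFun g := MonoidHom.toMulEquiv (LinkCoprod.permute v g) (LinkCoprod.permute v g⁻¹)
    (by rw [permute_comp, inv_mul_cancel, permute_one])
    (by rw [permute_comp, mul_inv_cancel, permute_one])
  map_one' := MulEquiv.ext fun x => DFunLike.congr_fun (LinkCoprod.permute_one v) x
  map_mul' g h := MulEquiv.ext fun x =>
    (DFunLike.congr_fun (LinkCoprod.permute_comp v g h) x).symm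

theorem LinkCoprod.aut_of {v : V} (g : GraphProduct Γ G) (c : LinkCosets Γ G v) (a : G v) :
    LinkCoprod.aut Γ G v g (LinkCoprod.of c a) = LinkCoprod.of (g • c) a :=
  LinkCoprod.permute_of g c a

/-- The semidirect product of the free product of copies of `G v` by the graph product. -/
abbrev LinkSemidirect (Γ : SimpleGraph V) (G : V → Type*) [∀ u, Group (G u)] (v : V) : Type _ :=
  LinkCoprod Γ G v ⋊[LinkCoprod.aut Γ G v] GraphProduct Γ G

/-- The inclusion of `G v` as the factor indexed by the trivial coset. -/
def baseFactor (v : V) : G v →* LinkSemidirect Γ G v :=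
  SemidirectProduct.inl.comp (LinkCoprod.of ((1 : GraphProduct Γ G) : LinkCosets Γ G v))

/-- Elements of `⟨link v⟩` fix the trivial coset, hence act trivially on the factor it indexes. This
is why the factors are indexed by cosets of the link. -/
theorem commute_baseFactor {v w : V} (hw : Γ.Adj v w) (a : G v) (b : G w) :
    Commute (baseFactor v a : LinkSemidirect Γ G v)
      (SemidirectProduct.inr (vertexHom Γ G w b)) := by
  have h1 : vertexHom Γ G w b • ((1 : GraphProduct Γ G) : LinkCosets Γ G v) =
      ((1 : GraphProduct Γ G) : LinkCosets Γ G v) := by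
    rw [MulAction.Quotient.smul_coe, QuotientGroup.eq, smul_eq_mul, mul_one, mul_one]
    exact inv_mem (vertexHom_mem_spanSubgroup hw b)
  have h2 := SemidirectProduct.inl_aut (φ := LinkCoprod.aut Γ G v) (vertexHom Γ G w b)
    (LinkCoprod.of ((1 : GraphProduct Γ G) : LinkCosets Γ G v) a)
  rw [LinkCoprod.aut_of, h1, map_inv] at h2
  exact eq_mul_inv_iff_mul_eq.1 h2

open Classical in
/-- The components of `splitting`. -/
def splittingAux (Γ : SimpleGraph V) (G : V → Type*) [∀ u, Group (G u)] (v : V) :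
    ∀ u, G u →* LinkSemidirect Γ G v :=
  Function.update (fun u => SemidirectProduct.inr.comp (vertexHom Γ G u)) v (baseFactor v)

theorem splittingAux_self (v : V) : splittingAux Γ G v v = baseFactor v := by
  classical exact Function.update_self _ _ _

theorem splittingAux_of_ne {u v : V} (h : u ≠ v) :
    splittingAux Γ G v u = SemidirectProduct.inr.comp (vertexHom Γ G u) := by
  classical exact Function.update_of_ne h _ _

theorem commute_splittingAux (v u w : V) (huw : Γ.Adj u w) (a : G u) (b : G w) :
    Commute (splittingAux Γ G v u a) (splittingAux Γ G v w b) := by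
  by_cases hu : u = v
  · subst hu
    rw [splittingAux_self, splittingAux_of_ne huw.ne']
    exact commute_baseFactor huw a b
  · by_cases hw : w = v
    · subst hw
      rw [splittingAux_self, splittingAux_of_ne hu]
      exact (commute_baseFactor huw.symm b a).symm
    · rw [splittingAux_of_ne hu, splittingAux_of_ne hw, MonoidHom.comp_apply, MonoidHom.comp_apply]
      exact (commute_vertexHom huw a b).map SemidirectProduct.inr

/-- The homomorphism from the graph product to the semidirect product of the free product of copies
of `G v` by the graph product; its second component kills `G v`. -/
def splitting (Γ : SimpleGraph V) (G : V → Type*) [∀ u, Group (G u)] (v : V) :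
    GraphProduct Γ G →* LinkSemidirect Γ G v :=
  GraphProduct.lift (splittingAux Γ G v) (commute_splittingAux v)

theorem splitting_vertexHom_self (v : V) (a : G v) :
    splitting Γ G v (vertexHom Γ G v a) =
      SemidirectProduct.inl (LinkCoprod.of ((1 : GraphProduct Γ G) : LinkCosets Γ G v) a) := by
  rw [splitting, GraphProduct.lift_vertexHom, splittingAux_self]
  rfl

theorem splitting_vertexHom_of_ne {u v : V} (h : u ≠ v) (a : G u) :
    splitting Γ G v (vertexHom Γ G u a) = SemidirectProduct.inr (vertexHom Γ G u a) := by
  rw [splitting, GraphProduct.lift_vertexHom, splittingAux_of_ne h]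
  rfl

/-- Conjugates of elements of `G v`, depending only on the coset of the conjugating element. -/
def linkConj (v : V) : LinkCoprod Γ G v →* GraphProduct Γ G :=
  CoprodI.lift fun c => (MulAut.conj c.out).toMonoidHom.comp (vertexHom Γ G v)

theorem commute_link {v : V} {n : GraphProduct Γ G}
    (hn : n ∈ spanSubgroup Γ G (Γ.neighborSet v)) (a : G v) :
    Commute n (vertexHom Γ G v a) := by
  have : spanSubgroup Γ G (Γ.neighborSet v) ≤ Subgroup.centralizer {vertexHom Γ G v a} :=
    spanSubgroup_le fun u hu b => by
      rw [Subgroup.mem_centralizer_singleton_iff]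
      exact ((commute_vertexHom hu a b).symm).eq
  exact Subgroup.mem_centralizer_singleton_iff.1 (this hn)

theorem linkConj_of {v : V} (g : GraphProduct Γ G) (a : G v) :
    linkConj v (LinkCoprod.of (g : LinkCosets Γ G v) a) = g * vertexHom Γ G v a * g⁻¹ := by
  have h1 : linkConj v (LinkCoprod.of (g : LinkCosets Γ G v) a) =
      (g : LinkCosets Γ G v).out * vertexHom Γ G v a * ((g : LinkCosets Γ G v).out)⁻¹ :=
    CoprodI.lift_of _ _
  obtain ⟨n, hn⟩ := QuotientGroup.mk_out_eq_mul (spanSubgroup Γ G (Γ.neighborSet v)) g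
  rw [h1, hn, mul_assoc g, (commute_link n.2 a).eq]
  group

/-- `linkConj` and the identity combine, by the universal property of the semidirect product, into a
left inverse of `splitting`. So an element is determined by its two components. -/
theorem splitting_left_mul_right (v : V) (g : GraphProduct Γ G) :
    linkConj v (splitting Γ G v g).left * (splitting Γ G v g).right = g := by
  have hcomp : ∀ g : GraphProduct Γ G, (linkConj v).comp (LinkCoprod.aut Γ G v g).toMonoidHom =
      (MulAut.conj (MonoidHom.id (GraphProduct Γ G) g)).toMonoidHom.comp (linkConj v) := by
    intro g
    refine LinkCoprod.hom_ext fun c a => ?_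
    induction c using QuotientGroup.induction_on with
    | H h =>
      change linkConj v (LinkCoprod.aut Γ G v g (LinkCoprod.of _ a)) = g * linkConj v _ * g⁻¹
      rw [LinkCoprod.aut_of, MulAction.Quotient.smul_coe, linkConj_of, linkConj_of, smul_eq_mul]
      group
  have key : (SemidirectProduct.lift (linkConj v) (MonoidHom.id _) hcomp).comp
      (splitting Γ G v) = MonoidHom.id _ := by
    refine GraphProduct.hom_ext fun u a => ?_
    rw [MonoidHom.comp_apply]
    by_cases h : u = v
    · subst h
      rw [splitting_vertexHom_self, SemidirectProduct.lift_inl, linkConj_of]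
      simp
    · rw [splitting_vertexHom_of_ne h, SemidirectProduct.lift_inr]
  exact DFunLike.congr_fun key g

theorem splitting_eq_inr {v : V} {g : GraphProduct Γ G} (hg : g ∈ spanSubgroup Γ G {v}ᶜ) :
    splitting Γ G v g = SemidirectProduct.inr g := by
  refine spanSubgroup_induction (p := fun g => splitting Γ G v g = SemidirectProduct.inr g)
    ?_ ?_ ?_ ?_ hg
  · exact fun u hu a => splitting_vertexHom_of_ne hu a
  · simp
  · intro g h _ _ h1 h2
    rw [map_mul, h1, h2, map_mul]
  · intro g _ h
    rw [map_inv, h, map_inv]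

theorem splitting_right (v : V) (g : GraphProduct Γ G) :
    (splitting Γ G v g).right = retraction Γ G {v}ᶜ g := by
  have : SemidirectProduct.rightHom.comp (splitting Γ G v) = retraction Γ G {v}ᶜ := by
    refine GraphProduct.hom_ext fun u a => ?_
    rw [MonoidHom.comp_apply]
    by_cases h : u = v
    · subst h
      rw [splitting_vertexHom_self, retraction_vertexHom_of_notMem (by simp)]
      simp
    · rw [splitting_vertexHom_of_ne h, retraction_vertexHom_of_mem (by simpa using h)]
      simp
  exact DFunLike.congr_fun this g

/-- The coset of `⟨link v⟩` given by the part of `g` that is free of `G v`. -/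
def linkCoset (v : V) (g : GraphProduct Γ G) : LinkCosets Γ G v :=
  (retraction Γ G {v}ᶜ g : GraphProduct Γ G)

open Classical in
/-- The list of the `v`-syllables of `g`, last syllable first, each inverted. -/
def syllables (v : V) (g : GraphProduct Γ G) : List (Σ _ : LinkCosets Γ G v, G v) :=
  -- Reduced words grow on the left, whereas crossing walls is right multiplication. Inverting
  -- exchanges the two, so that initial segments of `g` become suffixes of its list.
  (CoprodI.Word.equiv (M := fun _ : LinkCosets Γ G v => G v)
    ((splitting Γ G v g).left⁻¹)).toList

theorem syllables_eq_iff {v : V} {g h : GraphProduct Γ G} :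
    syllables v g = syllables v h ↔ (splitting Γ G v g).left = (splitting Γ G v h).left := by
  classical
  rw [syllables, syllables, ← CoprodI.Word.ext_iff, EmbeddingLike.apply_eq_iff_eq, inv_inj]

/-- Equal lists mean equal left components, and these cancel in `g⁻¹ * h`. -/
theorem inv_mul_eq_of_syllables_eq {v : V} {g h : GraphProduct Γ G}
    (hgh : syllables v g = syllables v h) :
    g⁻¹ * h = (retraction Γ G {v}ᶜ g)⁻¹ * retraction Γ G {v}ᶜ h := by
  have h1 := splitting_left_mul_right v g
  have h2 := splitting_left_mul_right v h
  rw [syllables_eq_iff.1 hgh] at h1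
  rw [splitting_right] at h1 h2
  generalize linkConj v (splitting Γ G v h).left = k at h1 h2
  rw [← eq_inv_mul_iff_mul_eq] at h1 h2
  rw [h1, h2]
  group

theorem syllables_one (v : V) : syllables v (1 : GraphProduct Γ G) = [] := by
  classical
  rw [syllables, map_one, SemidirectProduct.one_left, inv_one]
  change ((1 : LinkCoprod Γ G v) • CoprodI.Word.empty).toList = _
  rw [one_smul]
  rfl

theorem syllables_mul_of_mem {v : V} (g : GraphProduct Γ G) {h : GraphProduct Γ G}
    (hh : h ∈ spanSubgroup Γ G {v}ᶜ) : syllables v (g * h) = syllables v g := by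
  rw [syllables_eq_iff, map_mul, splitting_eq_inr hh, SemidirectProduct.mul_left,
    SemidirectProduct.left_inr, map_one, mul_one]

theorem linkCoset_mul_vertexHom {v : V} (g : GraphProduct Γ G) (a : G v) :
    linkCoset v (g * vertexHom Γ G v a) = linkCoset v g := by
  rw [linkCoset, linkCoset, map_mul, retraction_vertexHom_of_notMem (by simp), mul_one]

/-- The new letter starts in the base factor and is moved by the right component of `splitting g`,
which explains the index `linkCoset v g`. -/
theorem splitting_mul_vertexHom_left {v : V} (g : GraphProduct Γ G) (a : G v) :
    (splitting Γ G v (g * vertexHom Γ G v a)).left =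
      (splitting Γ G v g).left * LinkCoprod.of (linkCoset v g) a := by
  rw [map_mul, splitting_vertexHom_self, SemidirectProduct.mul_left, SemidirectProduct.left_inl,
    LinkCoprod.aut_of, splitting_right, MulAction.Quotient.smul_coe, smul_eq_mul, mul_one]
  rfl

/-- Multiplying a reduced word by a letter of one factor alters at most its head in that factor,
which may appear, change or vanish. The common tail `t` is what remains of both lists without this
head. -/
theorem syllables_mul_vertexHom (v : V) (g : GraphProduct Γ G) (a : G v) :
    ∃ t, (syllables v g = t ∨ ∃ m, syllables v g = ⟨linkCoset v g, m⟩ :: t) ∧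
      (syllables v (g * vertexHom Γ G v a) = t ∨
        ∃ m, syllables v (g * vertexHom Γ G v a) = ⟨linkCoset v g, m⟩ :: t) := by
  classical
  have rcons_cases : ∀ p : CoprodI.Word.Pair (fun _ : LinkCosets Γ G v => G v) (linkCoset v g),
      (CoprodI.Word.rcons p).toList = p.tail.toList ∨
        ∃ m, (CoprodI.Word.rcons p).toList = ⟨linkCoset v g, m⟩ :: p.tail.toList := by
    intro p
    by_cases h : p.head = 1
    · left
      rw [CoprodI.Word.rcons, dif_pos h]
    · right
      refine ⟨p.head, ?_⟩
      rw [CoprodI.Word.rcons, dif_neg h]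
      rfl
  let w := CoprodI.Word.equiv (M := fun _ : LinkCosets Γ G v => G v)
    ((splitting Γ G v g).left⁻¹)
  refine ⟨(CoprodI.Word.equivPair (linkCoset v g) w).tail.toList, ?_, ?_⟩
  · have := rcons_cases (CoprodI.Word.equivPair (linkCoset v g) w)
    rwa [← CoprodI.Word.equivPair_symm, Equiv.symm_apply_apply] at this
  · have h1 : syllables v (g * vertexHom Γ G v a) =
        (CoprodI.of (M := fun _ : LinkCosets Γ G v => G v) (i := linkCoset v g) a⁻¹ • w).toList := by
      rw [syllables, splitting_mul_vertexHom_left, mul_inv_rev, ← map_inv]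
      exact congrArg CoprodI.Word.toList
        (mul_smul (β := CoprodI.Word (fun _ : LinkCosets Γ G v => G v))
          (LinkCoprod.of (linkCoset v g) a⁻¹) (splitting Γ G v g).left⁻¹
          CoprodI.Word.empty)
    rw [h1, CoprodI.Word.of_smul_def]
    exact rcons_cases _

theorem splitting_left_of_syllables_cons {v : V} {g h : GraphProduct Γ G} {c : LinkCosets Γ G v} {m : G v}
    (hgh : syllables v g = ⟨c, m⟩ :: syllables v h) :
    (splitting Γ G v g).left = (splitting Γ G v h).left * LinkCoprod.of c m⁻¹ := by
  classical
  let e := CoprodI.Word.equiv (M := fun _ : LinkCosets Γ G v => G v)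
  have h1 : ∀ k : GraphProduct Γ G, ((splitting Γ G v k).left)⁻¹ =
      ((syllables v k).map fun l => LinkCoprod.of l.1 l.2).prod := fun k =>
    (e.symm_apply_apply ((splitting Γ G v k).left)⁻¹).symm
  have h2 : ((splitting Γ G v g).left)⁻¹ = LinkCoprod.of c m * ((splitting Γ G v h).left)⁻¹ := by
    rw [h1, h1, hgh, List.map_cons, List.prod_cons]
  rw [← inv_inv (splitting Γ G v g).left, h2, mul_inv_rev, inv_inv, map_inv]

end GraphProductAlgebra

/-! ### Walls given by suffixes of syllable lists, and their boundaries -/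

section Walls

variable {V : Type*} {Γ : SimpleGraph V} {G : V → Type*} [∀ u, Group (G u)]

/-- Multiplying an element of `⟨Λ⟩` by an element of a vertex-group indexed by `Λ` enters or leaves
`T` only at a point of `B`. -/
def HasBoundaryIn (Λ : Set V) (T B : Set (GraphProduct Γ G)) : Prop :=
  ∀ h ∈ spanSubgroup Γ G Λ, ∀ u ∈ Λ, ∀ a : G u, ¬ (h ∈ T ↔ h * vertexHom Γ G u a ∈ T) →
    h ∈ B ∨ h * vertexHom Γ G u a ∈ B

/-- Leaving through `a` is entering through `a⁻¹`, and the conclusion is symmetric in the two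
points. -/
theorem hasBoundaryIn_of_enter {Λ : Set V} {T B : Set (GraphProduct Γ G)}
    (H : ∀ (h : GraphProduct Γ G) (u : V) (a : G u), h ∉ T → h * vertexHom Γ G u a ∈ T →
      h ∈ B ∨ h * vertexHom Γ G u a ∈ B) : HasBoundaryIn Λ T B := by
  intro h _ u _ a hT
  by_cases hh : h ∈ T
  · have := H (h * vertexHom Γ G u a) u a⁻¹ (by tauto) (by
      rwa [map_inv, mul_inv_cancel_right])
    rw [map_inv, mul_inv_cancel_right] at this
    exact this.symm
  · exact H h u a hh (by tauto)

/-- Only a letter of `G v` changes the list, and only at its head. A suffix that appears in one step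
must therefore be the whole new list. -/
theorem syllables_of_enter {v : V} {x : Σ _ : LinkCosets Γ G v, G v}
    {p : List (Σ _ : LinkCosets Γ G v, G v)} {h : GraphProduct Γ G} {u : V} {a : G u}
    (h1 : ¬ (x :: p <:+ syllables v h)) (h2 : x :: p <:+ syllables v (h * vertexHom Γ G u a)) :
    syllables v (h * vertexHom Γ G u a) = x :: p ∧ linkCoset v h = x.1 ∧
      linkCoset v (h * vertexHom Γ G u a) = x.1 ∧
      (syllables v h = p ∨ ∃ m, syllables v h = ⟨x.1, m⟩ :: p) := by
  by_cases hu : u = v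
  · subst hu
    obtain ⟨t, ht1, ht2⟩ := syllables_mul_vertexHom u h a
    have hxt : ¬ (x :: p <:+ t) := by
      intro hx
      rcases ht1 with ht1 | ⟨m, ht1⟩
      · exact h1 (ht1 ▸ hx)
      · exact h1 (ht1 ▸ hx.trans (List.suffix_cons _ _))
    rcases ht2 with ht2 | ⟨m, ht2⟩
    · exact (hxt (ht2 ▸ h2)).elim
    rw [ht2, List.suffix_cons_iff] at h2
    have h3 := h2.resolve_right hxt
    obtain ⟨hx, rfl⟩ := List.cons_eq_cons.1 h3
    subst hx
    refine ⟨ht2, rfl, linkCoset_mul_vertexHom h a, ht1⟩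
  · rw [syllables_mul_of_mem h (vertexHom_mem_spanSubgroup (by simpa using hu) a)] at h2
    exact (h1 h2).elim

/-- This is the half-tree beyond an edge from a star vertex to the next vertex of type `⟨Λ ∖ v⟩`.
Its boundary is recorded on the inside. -/
theorem hasBoundaryIn_suffix (Λ : Set V) (v : V) (c : LinkCosets Γ G v) (m : G v)
    (p : List (Σ _ : LinkCosets Γ G v, G v)) :
    HasBoundaryIn Λ {h | ⟨c, m⟩ :: p <:+ syllables v h}
      {h | syllables v h = ⟨c, m⟩ :: p ∧ linkCoset v h = c} := by
  refine hasBoundaryIn_of_enter fun h u a h1 h2 => Or.inr ?_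
  obtain ⟨h3, -, h4, -⟩ := syllables_of_enter h1 h2
  exact ⟨h3, h4⟩

/-- This is the half-tree beyond an edge leading into a star vertex, with all branches `m` at that
vertex together. Its boundary is recorded on the outside, where the list is still `p`. -/
theorem hasBoundaryIn_exists_suffix (Λ : Set V) (v : V) (c : LinkCosets Γ G v)
    (p : List (Σ _ : LinkCosets Γ G v, G v)) :
    HasBoundaryIn Λ {h | ∃ m, ⟨c, m⟩ :: p <:+ syllables v h}
      {h | syllables v h = p ∧ linkCoset v h = c} := by
  refine hasBoundaryIn_of_enter fun h u a h1 h2 => Or.inl ?_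
  obtain ⟨m, h2⟩ := h2
  obtain ⟨-, h4, -, h5⟩ := syllables_of_enter (fun h => h1 ⟨m, h⟩) h2
  refine ⟨h5.resolve_right ?_, h4⟩
  rintro ⟨m', h6⟩
  exact h1 ⟨m', by rw [h6]⟩

theorem inv_mul_mem_of_syllables {Λ : Set V} {v : V} {h h' : GraphProduct Γ G}
    (hh : h ∈ spanSubgroup Γ G Λ) (hh' : h' ∈ spanSubgroup Γ G Λ)
    (hs : syllables v h = syllables v h') : h⁻¹ * h' ∈ spanSubgroup Γ G (Λ ∩ {v}ᶜ) := by
  refine mem_spanSubgroup_inter (mul_mem (inv_mem hh) hh') ?_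
  have key : ∀ k : GraphProduct Γ G, retraction Γ G {v}ᶜ k ∈ spanSubgroup Γ G {v}ᶜ := fun k =>
    spanSubgroup_mono Set.inter_subset_right
      (retraction_mem (Λ' := Set.univ) (by rw [spanSubgroup_univ]; trivial))
  rw [inv_mul_eq_of_syllables_eq hs]
  exact mul_mem (inv_mem (key h)) (key h')

/-- Since the lists agree, only the retractions differ, and they differ by an element of `⟨link v⟩`.
Hence each of the two boundaries above meets `⟨Λ⟩` inside a single coset of `⟨Λ ∩ link v⟩`. -/
theorem inv_mul_mem_of_syllables_of_linkCoset {Λ : Set V} {v : V} {h h' : GraphProduct Γ G}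
    (hh : h ∈ spanSubgroup Γ G Λ) (hh' : h' ∈ spanSubgroup Γ G Λ)
    (hs : syllables v h = syllables v h') (hc : linkCoset v h = linkCoset v h') :
    h⁻¹ * h' ∈ spanSubgroup Γ G (Λ ∩ Γ.neighborSet v) := by
  refine mem_spanSubgroup_inter (mul_mem (inv_mem hh) hh') ?_
  rw [inv_mul_eq_of_syllables_eq hs]
  exact QuotientGroup.eq.1 hc

/-- Appending the letter `m⁻¹` to `h` reaches the list of `h'`; the inverse comes from the inversion
in `syllables`. The two edges thus meet at one star vertex. -/
theorem inv_mul_mem_of_syllables_cons {Λ : Set V} {v : V} {h h' : GraphProduct Γ G}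
    {c : LinkCosets Γ G v} {m : G v} (hh : h ∈ spanSubgroup Γ G Λ)
    (hh' : h' ∈ spanSubgroup Γ G Λ) (hv : v ∈ Λ) (hs : syllables v h' = ⟨c, m⟩ :: syllables v h)
    (hc : linkCoset v h = c) (hc' : linkCoset v h' = c) :
    h⁻¹ * h' ∈ spanSubgroup Γ G (insert v (Λ ∩ Γ.neighborSet v)) := by
  have h1 : syllables v (h * vertexHom Γ G v m⁻¹) = syllables v h' := by
    rw [syllables_eq_iff, splitting_mul_vertexHom_left, splitting_left_of_syllables_cons hs, hc]
  have h2 := inv_mul_mem_of_syllables_of_linkCoset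
    (mul_mem hh (vertexHom_mem_spanSubgroup hv m⁻¹)) hh' h1
    (by rw [linkCoset_mul_vertexHom, hc, hc'])
  have h3 : h⁻¹ * h' = vertexHom Γ G v m⁻¹ * ((h * vertexHom Γ G v m⁻¹)⁻¹ * h') := by group
  rw [h3]
  exact mul_mem (vertexHom_mem_spanSubgroup (Set.mem_insert _ _) _)
    (spanSubgroup_mono (Set.subset_insert _ _) h2)

end Walls

/-! ### The dichotomy for subsets of graph products -/

section Dichotomy

/-- The separation clause of `CoarselySeparatedBy`, for given constants `k` and `L`. -/
def SeparatedAt {X : Type*} [MetricSpace X] (k L : ℝ) (Y : Set X) (𝒵 : Set (Set X)) : Prop :=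
  ∀ D : ℝ, 0 ≤ D → ∃ Z ∈ 𝒵,
    ∃ a ∈ Y \ Metric.cthickening L Z, ∃ b ∈ Y \ Metric.cthickening L Z,
      ENNReal.ofReal D ≤ Metric.infEDist a Z ∧ ENNReal.ofReal D ≤ Metric.infEDist b Z ∧
      ¬ JoinedByPath k (Y \ Metric.cthickening L Z) a b

theorem exists_dist_le_of_not_le_infEDist {X : Type*} [MetricSpace X] {D : ℝ} {x : X} {Z : Set X}
    (h : ¬ ENNReal.ofReal D ≤ Metric.infEDist x Z) : ∃ a ∈ Z, dist x a ≤ D := by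
  rw [not_le, Metric.infEDist_lt_iff] at h
  obtain ⟨a, ha, h⟩ := h
  refine ⟨a, ha, ?_⟩
  rw [edist_dist] at h
  exact ((ENNReal.ofReal_lt_ofReal_iff').1 h).1.le

theorem notMem_cthickening_of_le_infEDist {X : Type*} [MetricSpace X] {D L : ℝ} {x : X} {Z : Set X}
    (h : ENNReal.ofReal D ≤ Metric.infEDist x Z) (hL : 0 ≤ L) (hLD : L < D) :
    x ∉ Metric.cthickening L Z := by
  intro hx
  rw [Metric.mem_cthickening_iff] at hx
  have := (ENNReal.ofReal_le_ofReal_iff hL).1 (h.trans hx)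
  linarith

variable {V : Type*} {Γ : SimpleGraph V} {G : V → Type*} [∀ u, Group (G u)]

variable [MetricSpace (GraphProduct Γ G)]

/-- Spelling `t` with vertex-group elements gives a path from `h` to `h * t`, and one of its steps
crosses the boundary. The bound depends on `t` only, by left invariance. -/
theorem exists_dist_le_of_crossing (hinv : ∀ g a b : GraphProduct Γ G, dist (g * a) (g * b) = dist a b)
    {Λ : Set V} {t : GraphProduct Γ G} (ht : t ∈ spanSubgroup Γ G Λ) :
    ∃ C : ℝ, ∀ T B : Set (GraphProduct Γ G), HasBoundaryIn Λ T B →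
      ∀ h ∈ spanSubgroup Γ G Λ, ¬ (h ∈ T ↔ h * t ∈ T) →
        ∃ b ∈ B, b ∈ spanSubgroup Γ G Λ ∧ dist h b ≤ C := by
  have hd : ∀ h t : GraphProduct Γ G, dist h (h * t) = dist 1 t := fun h t => by
    simpa using hinv h 1 t
  refine spanSubgroup_induction (p := fun t => ∃ C : ℝ, ∀ T B : Set (GraphProduct Γ G),
    HasBoundaryIn Λ T B → ∀ h ∈ spanSubgroup Γ G Λ, ¬ (h ∈ T ↔ h * t ∈ T) →
        ∃ b ∈ B, b ∈ spanSubgroup Γ G Λ ∧ dist h b ≤ C) ?_ ?_ ?_ ?_ ht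
  · intro u hu a
    refine ⟨dist 1 (vertexHom Γ G u a), fun T B hTB h hh hT => ?_⟩
    rcases hTB h hh u hu a hT with hb | hb
    · exact ⟨h, hb, hh, by simp⟩
    · exact ⟨_, hb, mul_mem hh (vertexHom_mem_spanSubgroup hu a), (hd _ _).le⟩
  · exact ⟨0, fun T B _ h _ hT => (hT (by simp)).elim⟩
  · rintro s t hs - ⟨C, hC⟩ ⟨C', hC'⟩
    refine ⟨max C (dist 1 s + C'), fun T B hTB h hh hT => ?_⟩
    by_cases h1 : h ∈ T ↔ h * s ∈ T
    · obtain ⟨b, hb, hb', hdb⟩ := hC' T B hTB (h * s) (mul_mem hh hs) (by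
        rw [← mul_assoc] at hT
        tauto)
      refine ⟨b, hb, hb', le_max_of_le_right ?_⟩
      have := dist_triangle h (h * s) b
      rw [hd] at this
      linarith
    · obtain ⟨b, hb, hb', hdb⟩ := hC T B hTB h hh h1
      exact ⟨b, hb, hb', le_max_of_le_left hdb⟩
  · rintro t ht ⟨C, hC⟩
    refine ⟨dist 1 t⁻¹ + C, fun T B hTB h hh hT => ?_⟩
    obtain ⟨b, hb, hb', hdb⟩ := hC T B hTB (h * t⁻¹) (mul_mem hh (inv_mem ht)) (by
      rw [inv_mul_cancel_right]
      tauto)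
    refine ⟨b, hb, hb', ?_⟩
    have := dist_triangle h (h * t⁻¹) b
    rw [hd] at this
    linarith

/-- The displacement `h⁻¹ * h'` ranges over a finite ball, so the bounds of the previous lemma have
a maximum. -/
theorem exists_uniform_dist_le_of_crossing
    (hinv : ∀ g a b : GraphProduct Γ G, dist (g * a) (g * b) = dist a b)
    (hfin : ∀ r, (Metric.closedBall (1 : GraphProduct Γ G) r).Finite) (Λ : Set V) (K : ℝ) :
    ∃ C : ℝ, 0 ≤ C ∧ ∀ T B : Set (GraphProduct Γ G), HasBoundaryIn Λ T B →
      ∀ h ∈ spanSubgroup Γ G Λ, ∀ h' ∈ spanSubgroup Γ G Λ, dist h h' ≤ K → ¬ (h ∈ T ↔ h' ∈ T) →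
        ∃ b ∈ B, b ∈ spanSubgroup Γ G Λ ∧ dist h b ≤ C := by
  choose! C hC using fun (t : GraphProduct Γ G) (ht : t ∈ spanSubgroup Γ G Λ) =>
    exists_dist_le_of_crossing hinv ht
  obtain ⟨M, hM⟩ := ((hfin K).image C).bddAbove
  refine ⟨max M 0, le_max_right _ _, fun T B hTB h hh h' hh' hd hT => ?_⟩
  have ht : h⁻¹ * h' ∈ spanSubgroup Γ G Λ := mul_mem (inv_mem hh) hh'
  have hd' : dist (h⁻¹ * h') 1 ≤ K := by
    rw [← hinv h, mul_inv_cancel_left, mul_one, dist_comm]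
    exact hd
  obtain ⟨b, hb, hb', hdb⟩ := hC _ ht T B hTB h hh (by rwa [mul_inv_cancel_left])
  exact ⟨b, hb, hb', hdb.trans (le_max_of_le_left (hM ⟨_, hd', rfl⟩))⟩

/-- If `Y`, contained in a neighbourhood of `g⟨Λ⟩`, is not coarsely separated by the cosets of
clique-subgroups, then a subset of `g⟨Λ⟩` with boundary in such a coset has `Y` close to this coset
on one of its two sides. -/
theorem exists_side_near_of_not_separatedAt
    (hinv : ∀ g a b : GraphProduct Γ G, dist (g * a) (g * b) = dist a b)
    (hfin : ∀ r, (Metric.closedBall (1 : GraphProduct Γ G) r).Finite) {Λ : Set V}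
    {Y : Set (GraphProduct Γ G)} {k R : ℝ} {π : GraphProduct Γ G → GraphProduct Γ G}
    {g : GraphProduct Γ G} (hR0 : 0 ≤ R) (hπ : ∀ y ∈ Y, π y ∈ spanSubgroup Γ G Λ)
    (hR : ∀ y ∈ Y, dist y (g * π y) ≤ R)
    (hsep : ¬ ∃ L, 0 ≤ L ∧ SeparatedAt k L Y (cliqueCosets Γ G)) :
    ∃ D, R ≤ D ∧ ∀ T B A : Set (GraphProduct Γ G), HasBoundaryIn Λ T B → A ∈ cliqueCosets Γ G →
      (∀ b ∈ B, b ∈ spanSubgroup Γ G Λ → g * b ∈ A) →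
      (∀ y ∈ Y, π y ∈ T → ∃ a ∈ A, dist y a ≤ D) ∨ (∀ y ∈ Y, π y ∉ T → ∃ a ∈ A, dist y a ≤ D) := by
  -- Projecting a `k`-step of `Y` to the coset costs `R` at each end. Non-separation is then used
  -- with `L = C + R`.
  obtain ⟨C, hC0, hC⟩ := exists_uniform_dist_le_of_crossing hinv hfin Λ (k + 2 * R)
  have h0 : ¬ SeparatedAt k (C + R) Y (cliqueCosets Γ G) := fun h =>
    hsep ⟨C + R, by positivity, h⟩
  rw [SeparatedAt] at h0
  push Not at h0
  obtain ⟨D, hD0, hD⟩ := h0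
  -- The second term puts points farther than this from `A` outside its closed `(C +
  -- R)`-neighbourhood.
  refine ⟨max D (C + R + 1), le_max_of_le_right (by linarith), fun T B A hTB hA hBA => ?_⟩
  by_contra hcon
  push Not at hcon
  obtain ⟨⟨a, haY, haT, ha⟩, ⟨b, hbY, hbT, hb⟩⟩ := hcon
  have hfar : ∀ y : GraphProduct Γ G, (∀ a ∈ A, max D (C + R + 1) < dist y a) →
      ENNReal.ofReal (max D (C + R + 1)) ≤ Metric.infEDist y A := by
    intro y hy
    by_contra h
    obtain ⟨a, ha, h⟩ := exists_dist_le_of_not_le_infEDist h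
    exact (hy a ha).not_ge h
  have hCR : C + R < max D (C + R + 1) := lt_max_of_lt_right (by linarith)
  have ha' := notMem_cthickening_of_le_infEDist (hfar a ha) (by positivity) hCR
  have hb' := notMem_cthickening_of_le_infEDist (hfar b hb) (by positivity) hCR
  have hle : ENNReal.ofReal D ≤ ENNReal.ofReal (max D (C + R + 1)) :=
    ENNReal.ofReal_le_ofReal (le_max_left _ _)
  obtain ⟨n, p, p0, pn, hp, hstep⟩ := hD A hA a ⟨haY, ha'⟩ b ⟨hbY, hb'⟩ (hle.trans (hfar a ha))
    (hle.trans (hfar b hb))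
  -- A path from one side to the other has a step that changes sides. This step is close to the
  -- boundary, hence to `A`, which the path was supposed to avoid.
  obtain ⟨i, hi, hi1, hi2⟩ : ∃ i < n, π (p i) ∈ T ∧ π (p (i + 1)) ∉ T := by
    by_contra hno
    push Not at hno
    have : ∀ i ≤ n, π (p i) ∈ T := by
      intro i
      induction i with
      | zero => intro _; rwa [p0]
      | succ i ih => exact fun hi => hno i hi (ih (by omega))
    exact hbT (pn ▸ this n le_rfl)
  have hY1 := (hp i hi.le).1
  have hY2 := (hp (i + 1) hi).1
  have hd : dist (π (p i)) (π (p (i + 1))) ≤ k + 2 * R := by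
    rw [← hinv g]
    have h1 := hR _ hY1
    have h2 := hR _ hY2
    have h3 := hstep i hi
    rw [dist_comm] at h1
    have h4 := dist_triangle4 (g * π (p i)) (p i) (p (i + 1)) (g * π (p (i + 1)))
    linarith
  obtain ⟨c, hc, hcΛ, hdc⟩ := hC T B hTB _ (hπ _ hY1) _ (hπ _ hY2) hd (by tauto)
  refine (hp i hi.le).2 (Metric.mem_cthickening_of_dist_le _ (g * c) _ _ (hBA c hc hcΛ) ?_)
  have h1 := hR _ hY1
  have h2 := dist_triangle (p i) (g * π (p i)) (g * c)
  rw [hinv] at h2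
  linarith

/-- The inductive step of the dichotomy: removal of a vertex whose link in `Λ` is a clique. -/
theorem near_or_near_of_not_separatedAt
    (hinv : ∀ g a b : GraphProduct Γ G, dist (g * a) (g * b) = dist a b)
    (hfin : ∀ r, (Metric.closedBall (1 : GraphProduct Γ G) r).Finite) {Λ : Set V} {v : V}
    (hv : v ∈ Λ) (hcl : Γ.IsClique (Λ ∩ Γ.neighborSet v)) {Y : Set (GraphProduct Γ G)} {k R : ℝ}
    {π : GraphProduct Γ G → GraphProduct Γ G} {g y₀ : GraphProduct Γ G} (hy₀ : y₀ ∈ Y)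
    (hπ₀ : π y₀ = 1) (hπ : ∀ y ∈ Y, π y ∈ spanSubgroup Γ G Λ)
    (hR : ∀ y ∈ Y, dist y (g * π y) ≤ R)
    (hsep : ¬ ∃ L, 0 ≤ L ∧ SeparatedAt k L Y (cliqueCosets Γ G)) :
    (∃ A ∈ cliqueCosets Γ G, ∃ R' : ℝ, ∀ y ∈ Y, ∃ a ∈ A, dist y a ≤ R') ∨
      ∃ (g' : GraphProduct Γ G) (R' : ℝ), ∀ y ∈ Y, ∃ h ∈ spanSubgroup Γ G (Λ ∩ {v}ᶜ),
        dist y (g' * h) ≤ R' := by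
  have hR0 : 0 ≤ R := dist_nonneg.trans (hR y₀ hy₀)
  obtain ⟨D, hRD, hside⟩ := exists_side_near_of_not_separatedAt hinv hfin hR0 hπ hR hsep
  set N := Λ ∩ Γ.neighborSet v with hN
  have hNΛ : N ⊆ Λ ∩ {v}ᶜ := fun u hu => ⟨hu.1, fun h => by
    rw [Set.mem_singleton_iff] at h
    subst h
    exact Γ.irrefl hu.2⟩
  have hNcl : Γ.IsClique (insert v N) := hcl.insert fun u hu _ => hu.2
  have hcoset : ∀ x : GraphProduct Γ G,
      (fun h => g * x * h) '' (spanSubgroup Γ G N : Set (GraphProduct Γ G)) ∈ cliqueCosets Γ G :=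
    fun x => ⟨N, g * x, hcl, rfl⟩
  have hmem : ∀ x b : GraphProduct Γ G, x⁻¹ * b ∈ spanSubgroup Γ G N →
      g * b ∈ (fun h => g * x * h) '' (spanSubgroup Γ G N : Set (GraphProduct Γ G)) :=
    fun x b h => ⟨x⁻¹ * b, h, by group⟩
  have hcross : ∀ T B, HasBoundaryIn Λ T B → ∀ t ∈ spanSubgroup Γ G Λ, (1 : GraphProduct Γ G) ∉ T →
      t ∈ T → ∃ b ∈ B, b ∈ spanSubgroup Γ G Λ := by
    intro T B hTB t ht h1 htT
    obtain ⟨C, -, hC⟩ := exists_uniform_dist_le_of_crossing hinv hfin Λ (dist 1 t)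
    obtain ⟨b, hb, hb', -⟩ := hC T B hTB 1 (one_mem _) t ht le_rfl (by tauto)
    exact ⟨b, hb, hb'⟩
  -- walls beyond which there is a point of `Y` far away from the wall
  let deep : Set (List (Σ _ : LinkCosets Γ G v, G v)) :=
    {q | ∃ c m p, q = ⟨c, m⟩ :: p ∧ ∃ h ∈ spanSubgroup Γ G Λ, syllables v h = q ∧
      linkCoset v h = c ∧ ∃ y ∈ Y, q <:+ syllables v (π y) ∧
        ∀ n ∈ spanSubgroup Γ G N, D < dist y (g * h * n)}
  -- The far side of a deep wall contains a point of `Y` far from the wall, so `hside` leaves only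
  -- the other alternative: the points of `Y` on the near side are close to the wall.
  have hnear : ∀ c m p, ∀ h ∈ spanSubgroup Γ G Λ, syllables v h = ⟨c, m⟩ :: p →
      linkCoset v h = c → ⟨c, m⟩ :: p ∈ deep → ∀ y ∈ Y, ¬ (⟨c, m⟩ :: p <:+ syllables v (π y)) →
        ∃ n ∈ spanSubgroup Γ G N, dist y (g * h * n) ≤ D := by
    rintro c m p h hh hhs hhc ⟨c', m', p', he, h', hh', hhs', hhc', y, hy, hys, hyd⟩
    obtain ⟨he1, rfl⟩ := List.cons_eq_cons.1 he
    have hcc : c = c' := congrArg Sigma.fst he1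
    rcases hside _ _ _ (hasBoundaryIn_suffix Λ v c m p) (hcoset h') (by
      rintro b ⟨hb1, hb2⟩ hbΛ
      exact hmem _ _ (inv_mul_mem_of_syllables_of_linkCoset hh' hbΛ (hhs'.trans hb1.symm)
        (by rw [hhc', hb2, hcc]))) with h1 | h1
    · obtain ⟨_, ⟨n, hn, rfl⟩, hd⟩ := h1 y hy hys
      exact ((hyd n hn).not_ge hd).elim
    · intro z hz hzs
      obtain ⟨_, ⟨n, hn, rfl⟩, hd⟩ := h1 z hz hzs
      refine ⟨h⁻¹ * h' * n, mul_mem (inv_mul_mem_of_syllables_of_linkCoset hh hh'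
        (hhs.trans hhs'.symm) (by rw [hhc', hhc, hcc])) hn, ?_⟩
      have : g * h * (h⁻¹ * h' * n) = g * h' * n := by group
      rwa [this]
  -- The base point projects to 1 and has no syllables, so it is on the near side of every deep
  -- wall. Each such wall therefore meets the ball of radius `D + R` about 1.
  have hdeepfin : deep.Finite := by
    refine ((hfin (D + R)).image (syllables v)).subset ?_
    rintro q ⟨c, m, p, rfl, h, hh, hhs, hhc, hy⟩
    obtain ⟨n, hn, hd⟩ := hnear c m p h hh hhs hhc ⟨c, m, p, rfl, h, hh, hhs, hhc, hy⟩ y₀ hy₀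
      (by simp [hπ₀, syllables_one])
    refine ⟨h * n, ?_, ?_⟩
    · have h1 := hR y₀ hy₀
      rw [hπ₀] at h1
      rw [Metric.mem_closedBall, dist_comm, ← hinv g]
      rw [dist_comm] at h1
      have := dist_triangle (g * 1) y₀ (g * (h * n))
      rw [← mul_assoc] at this ⊢
      linarith
    · rw [syllables_mul_of_mem h (spanSubgroup_mono (hNΛ.trans Set.inter_subset_right) hn), hhs]
  -- A longest deep wall is a last edge with points of `Y` far beyond it. The empty list stands for
  -- the base vertex when no wall is deep.
  obtain ⟨p, hp, hmax⟩ := Set.exists_max_image (insert [] deep) List.length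
    (hdeepfin.insert _) ⟨[], Set.mem_insert _ _⟩
  obtain ⟨hq, hqΛ, hqs, hqnear⟩ : ∃ hq ∈ spanSubgroup Γ G Λ, syllables v hq = p ∧
      ∀ y ∈ Y, ¬ (p <:+ syllables v (π y)) →
        ∃ n ∈ spanSubgroup Γ G (Λ ∩ {v}ᶜ), dist y (g * hq * n) ≤ D := by
    rcases hp with rfl | hp
    · exact ⟨1, one_mem _, syllables_one v, fun y _ h => (h (List.nil_suffix)).elim⟩
    · obtain ⟨c, m, p', rfl, h, hh, hhs, hhc, -⟩ := id hp
      refine ⟨h, hh, hhs, fun y hy hys => ?_⟩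
      obtain ⟨n, hn, hd⟩ := hnear c m p' h hh hhs hhc hp y hy hys
      exact ⟨n, spanSubgroup_mono hNΛ hn, hd⟩
  by_cases hall : ∀ y ∈ Y, ∃ n ∈ spanSubgroup Γ G (Λ ∩ {v}ᶜ), dist y (g * hq * n) ≤ D
  · exact Or.inr ⟨g * hq, D, hall⟩
  left
  push Not at hall
  obtain ⟨y, hy, hyfar⟩ := hall
  have hpy : p <:+ syllables v (π y) := by
    by_contra h
    obtain ⟨n, hn, hd⟩ := hqnear y hy h
    exact (hyfar n hn).not_ge hd
  -- If the list of `π y` were exactly `p`, then `π y` would lie in `hq⟨Λ ∖ v⟩` and `y` within `R ≤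
  -- D` of the coset from which it is far.
  obtain ⟨c, m, hcm⟩ : ∃ c m, ⟨c, m⟩ :: p <:+ syllables v (π y) := by
    obtain ⟨l, hl⟩ := hpy
    rcases List.eq_nil_or_concat l with rfl | ⟨l', ⟨c, m⟩, rfl⟩
    · have h1 : hq⁻¹ * π y ∈ spanSubgroup Γ G (Λ ∩ {v}ᶜ) :=
        inv_mul_mem_of_syllables hqΛ (hπ y hy) (hqs.trans hl)
      have h2 := hyfar _ h1
      rw [mul_assoc, mul_inv_cancel_left] at h2
      linarith [hR y hy]
    · exact ⟨c, m, l', by rw [← hl]; simp⟩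
  -- The far point `y` lies beyond the edge into the star vertex `c`. This edge is inside the coset
  -- from which `y` is far, so `hside` brings everything outside `T` close to it.
  have hT := hasBoundaryIn_exists_suffix (Γ := Γ) Λ v c p
  have h1T : (1 : GraphProduct Γ G) ∉ {h : GraphProduct Γ G | ∃ m, ⟨c, m⟩ :: p <:+ syllables v h} := by
    rintro ⟨m, hm⟩
    rw [syllables_one] at hm
    simp at hm
  obtain ⟨h, ⟨hhs, hhc⟩, hhΛ⟩ := hcross _ _ hT (π y) (hπ y hy) h1T ⟨m, hcm⟩
  rcases hside _ _ _ hT (hcoset h) (by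
      rintro b ⟨hb1, hb2⟩ hbΛ
      exact hmem _ _ (inv_mul_mem_of_syllables_of_linkCoset hhΛ hbΛ (hhs.trans hb1.symm)
        (by rw [hhc, hb2]))) with h1 | h1
  · obtain ⟨_, ⟨n, hn, rfl⟩, hd⟩ := h1 y hy ⟨m, hcm⟩
    refine ((hyfar (hq⁻¹ * h * n) (mul_mem (inv_mul_mem_of_syllables hqΛ hhΛ (hqs.trans hhs.symm))
      (spanSubgroup_mono hNΛ hn))).not_ge ?_).elim
    have : g * hq * (hq⁻¹ * h * n) = g * h * n := by group
    rwa [this]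
  · refine ⟨_, ⟨insert v N, g * h, hNcl, rfl⟩, D, fun z hz => ?_⟩
    by_cases hzT : ∃ m, ⟨c, m⟩ :: p <:+ syllables v (π z)
    · obtain ⟨m', hm'⟩ := hzT
      obtain ⟨h', ⟨hhs', hhc'⟩, hhΛ'⟩ := hcross _ _ (hasBoundaryIn_suffix Λ v c m' p) (π z) (hπ z hz)
        (by rw [Set.mem_ofPred_eq, syllables_one]; simp) hm'
      -- The walls on the other side of the star vertex have longer lists than `p`, so by maximality
      -- none is deep and the points of `Y` beyond them are close to them. All these walls lie in
      -- one coset of `⟨N ∪ v⟩`.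
      have hnd : ⟨c, m'⟩ :: p ∉ deep := fun hd => by
        have := hmax _ (Set.mem_insert_of_mem _ hd)
        simp at this
      have : ∃ n ∈ spanSubgroup Γ G N, dist z (g * h' * n) ≤ D := by
        by_contra hcon
        push Not at hcon
        exact hnd ⟨c, m', p, rfl, h', hhΛ', hhs', hhc', z, hz, hm', hcon⟩
      obtain ⟨n, hn, hd⟩ := this
      refine ⟨g * h' * n, ⟨h⁻¹ * h' * n, mul_mem (inv_mul_mem_of_syllables_cons hhΛ hhΛ' hv
        (by rw [hhs', hhs]) hhc hhc') (spanSubgroup_mono (Set.subset_insert _ _) hn), ?_⟩, hd⟩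
      group
    · obtain ⟨_, ⟨n, hn, rfl⟩, hd⟩ := h1 z hz hzT
      exact ⟨_, ⟨n, spanSubgroup_mono (Set.subset_insert _ _) hn, rfl⟩, hd⟩

/-- The dichotomy for a subset of a neighbourhood of a coset of `⟨Λ⟩`. -/
theorem near_or_separatedAt_of_near_coset [Finite V] (hΓ : IsChordal Γ)
    (hinv : ∀ g a b : GraphProduct Γ G, dist (g * a) (g * b) = dist a b)
    (hfin : ∀ r, (Metric.closedBall (1 : GraphProduct Γ G) r).Finite) (Λ : Set V)
    (Y : Set (GraphProduct Γ G)) (k : ℝ) (g : GraphProduct Γ G) (R : ℝ)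
    (hR : ∀ y ∈ Y, ∃ h ∈ spanSubgroup Γ G Λ, dist y (g * h) ≤ R) :
    (∃ A ∈ cliqueCosets Γ G, ∃ R' : ℝ, ∀ y ∈ Y, ∃ a ∈ A, dist y a ≤ R') ∨
      ∃ L, 0 ≤ L ∧ SeparatedAt k L Y (cliqueCosets Γ G) := by
  induction hn : Λ.ncard using Nat.strong_induction_on generalizing Λ g R with
  | _ n ih =>
  rcases Λ.eq_empty_or_nonempty with rfl | hΛ
  · exact Or.inl ⟨_, ⟨∅, g, by simp, rfl⟩, R, fun y hy => by
      obtain ⟨h, hh, hd⟩ := hR y hy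
      exact ⟨_, ⟨h, hh, rfl⟩, hd⟩⟩
  rcases Y.eq_empty_or_nonempty with rfl | ⟨y₀, hy₀⟩
  · exact Or.inl ⟨_, ⟨∅, g, by simp, rfl⟩, R, by simp⟩
  by_cases hsep : ∃ L, 0 ≤ L ∧ SeparatedAt k L Y (cliqueCosets Γ G)
  · exact Or.inr hsep
  left
  obtain ⟨v, hv, hcl⟩ := hΓ.exists_simplicial Λ hΛ
  choose! π hπ hd using hR
  -- Translating by `π y₀` gives the base point trivial projection, hence no syllables.
  rcases near_or_near_of_not_separatedAt hinv hfin hv hcl (R := R) (π := fun y => (π y₀)⁻¹ * π y)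
    (g := g * π y₀) hy₀ (inv_mul_cancel _) (fun y hy => mul_mem (inv_mem (hπ y₀ hy₀)) (hπ y hy))
    (fun y hy => by
      rw [mul_assoc, mul_inv_cancel_left]
      exact hd y hy) hsep with h | ⟨g', R', h⟩
  · exact h
  · refine (ih _ ?_ (Λ ∩ {v}ᶜ) g' R' h rfl).resolve_right hsep
    rw [← hn]
    exact Set.ncard_lt_ncard ⟨Set.inter_subset_left, fun h => (h hv).2 rfl⟩ (Set.toFinite _)

/-- The dichotomy for arbitrary subsets of graph products over finite chordal graphs. -/
theorem near_or_separatedAt [Finite V] (hΓ : IsChordal Γ)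
    (hinv : ∀ g a b : GraphProduct Γ G, dist (g * a) (g * b) = dist a b)
    (hfin : ∀ r, (Metric.closedBall (1 : GraphProduct Γ G) r).Finite)
    (Y : Set (GraphProduct Γ G)) (k : ℝ) :
    (∃ A ∈ cliqueCosets Γ G, ∃ R : ℝ, ∀ y ∈ Y, ∃ a ∈ A, dist y a ≤ R) ∨
      ∃ L, 0 ≤ L ∧ SeparatedAt k L Y (cliqueCosets Γ G) :=
  near_or_separatedAt_of_near_coset hΓ hinv hfin Set.univ Y k 1 0 fun y _ =>
    ⟨y, by rw [spanSubgroup_univ]; trivial, by simp⟩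

end Dichotomy

/-! ### Word metrics and coarse embeddings -/

section WordSpaces

theorem finite_setOf_wordLength_le {H : Type*} [Group H] {S : Set H} (hS : Subgroup.closure S = ⊤)
    (hfin : S.Finite) (n : ℕ) : {g : H | wordLength S g ≤ n}.Finite := by
  have h1 : (S ∪ S⁻¹).Finite := hfin.union hfin.inv
  have : Finite ↥(S ∪ S⁻¹) := h1
  refine ((List.finite_length_le ↥(S ∪ S⁻¹) n).image
    fun l => (l.map Subtype.val).prod).subset ?_
  intro g hg
  obtain ⟨l, hl, hlS, rfl⟩ := exists_word hS g
  refine ⟨l.attach.map fun x => ⟨x.1, hlS x.1 x.2⟩, ?_, ?_⟩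
  · have : l.length ≤ n := hl.trans_le hg
    simpa using this
  · simp

theorem near_or_separatedAt_wordSpace {V : Type*} [Finite V] {Γ : SimpleGraph V}
    (hΓ : IsChordal Γ) {G : V → Type*} [∀ u, Group (G u)] {S : Set (GraphProduct Γ G)}
    (hfin : S.Finite) (hS : Subgroup.closure S = ⊤) (Y : Set (WordSpace S hS)) (k : ℝ) :
    (∃ A : Set (WordSpace S hS), A ∈ cliqueCosets Γ G ∧ ∃ R : ℝ, ∀ y ∈ Y, ∃ a ∈ A, dist y a ≤ R) ∨
      ∃ L, 0 ≤ L ∧ SeparatedAt k L Y (cliqueCosets Γ G) := by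
  let _ : MetricSpace (GraphProduct Γ G) := wordMetric S hS
  refine near_or_separatedAt hΓ ?_ ?_ Y k
  · intro g a b
    change ((wordLength S ((g * a)⁻¹ * (g * b)) : ℕ) : ℝ) = (wordLength S (a⁻¹ * b) : ℕ)
    congr 2
    group
  · intro r
    refine (finite_setOf_wordLength_le hS hfin ⌊r⌋₊).subset fun g hg => ?_
    rw [Metric.mem_closedBall, dist_comm] at hg
    have h1 : ((wordLength S ((1 : GraphProduct Γ G)⁻¹ * g) : ℕ) : ℝ) ≤ r := hg
    rw [inv_one, one_mul] at h1
    exact Nat.le_floor h1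

/-- A geodesic is sampled at integer times, with the last time truncated at its length, and then
mapped by `ρ`. -/
theorem isCoarselyConnected_range {Z X : Type*} [MetricSpace Z] [MetricSpace X]
    (hZ : IsGeodesicSpace Z) {ρ : Z → X} {k : ℝ} (hρ : ∀ x y, dist x y ≤ 1 → dist (ρ x) (ρ y) ≤ k) :
    IsCoarselyConnected k (Set.range ρ) := by
  rintro _ ⟨x, rfl⟩ _ ⟨y, rfl⟩
  obtain ⟨γ, h0, h1, hγ⟩ := hZ x y
  refine ⟨⌈dist x y⌉₊, fun i => ρ (γ (min i (dist x y))), ?_, ?_, fun i _ => ⟨_, rfl⟩, ?_⟩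
  · simp [h0, dist_nonneg]
  · change ρ (γ (min ((⌈dist x y⌉₊ : ℕ) : ℝ) (dist x y))) = ρ y
    rw [min_eq_right (Nat.le_ceil _), h1]
  · intro i _
    have hmem : ∀ j : ℕ, min (j : ℝ) (dist x y) ∈ Set.Icc 0 (dist x y) := fun j =>
      ⟨le_min (Nat.cast_nonneg j) dist_nonneg, min_le_right _ _⟩
    refine hρ _ _ ?_
    rw [hγ _ (hmem i) _ (hmem (i + 1))]
    refine (abs_min_sub_min_le_max _ _ _ _).trans ?_
    simp

theorem IsCoarseEmbedding.exists_dist_le {X Y : Type*} [MetricSpace X] [MetricSpace Y] {f : X → Y}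
    (hf : IsCoarseEmbedding f) (r : ℝ) :
    ∃ k, 0 ≤ k ∧ ∀ x y, dist x y ≤ r → dist (f x) (f y) ≤ k := by
  obtain ⟨σ₁, σ₂, -, h2, -, h⟩ := hf
  exact ⟨max (σ₂ r) 0, le_max_right _ _, fun x y hxy =>
    (h x y).2.trans ((h2 hxy).trans (le_max_left _ _))⟩

theorem IsCoarseEmbedding.exists_dist_le_of_dist_le {X Y : Type*} [MetricSpace X] [MetricSpace Y]
    {f : X → Y} (hf : IsCoarseEmbedding f) (r : ℝ) :
    ∃ k, 0 ≤ k ∧ ∀ x y, dist (f x) (f y) ≤ r → dist x y ≤ k := by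
  obtain ⟨σ₁, σ₂, -, -, h3, h⟩ := hf
  obtain ⟨k, hk⟩ := Filter.eventually_atTop.1 (h3.eventually_gt_atTop r)
  refine ⟨max k 0, le_max_right _ _, fun x y hxy => ?_⟩
  by_contra hcon
  rw [not_le] at hcon
  have := hk _ ((le_max_left k 0).trans hcon.le)
  linarith [(h x y).1]

end WordSpaces

/-! ### Growth of clique-subgroups in right-angled Artin groups -/

section Exponents

variable {V : Type*} {Γ : SimpleGraph V}

open Classical in
/-- The abelianization of a right-angled Artin group. -/
def exponents (Γ : SimpleGraph V) : RAAG Γ →* (V → Multiplicative ℤ) :=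
  GraphProduct.lift (fun u => MonoidHom.mulSingle (fun _ : V => Multiplicative ℤ) u)
    fun _ _ _ _ _ => Commute.all _ _

open Classical in
theorem exponents_vertexHom (u : V) (a : Multiplicative ℤ) :
    exponents Γ (vertexHom Γ (fun _ : V => Multiplicative ℤ) u a) = Pi.mulSingle u a :=
  GraphProduct.lift_vertexHom (G := fun _ : V => Multiplicative ℤ) _ _ u a

theorem exponents_eq_one_of_notMem {Λ : Set V} {g : RAAG Γ} (hg : g ∈ spanSubgroup Γ (fun _ : V => Multiplicative ℤ) Λ) {u : V}
    (hu : u ∉ Λ) : exponents Γ g u = 1 := by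
  classical
  refine spanSubgroup_induction (p := fun g => exponents Γ g u = 1) ?_ ?_ ?_ ?_ hg
  · intro w hw a
    rw [exponents_vertexHom]
    exact Pi.mulSingle_eq_of_ne (M := fun _ : V => Multiplicative ℤ)
      (fun h : u = w => hu (h ▸ hw)) a
  · rw [map_one, Pi.one_apply]
  · intro g h _ _ h1 h2
    rw [map_mul, Pi.mul_apply, h1, h2, one_mul]
  · intro g _ h1
    rw [map_inv, Pi.inv_apply, h1, inv_one]

/-- The vertex-groups of a clique commute, so their inclusions assemble into a homomorphism from the
direct product that inverts `exponents` on `⟨Λ⟩`. -/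
theorem exponents_injOn_of_isClique [Finite V] {Λ : Set V} (hΛ : Γ.IsClique Λ) :
    Set.InjOn (exponents Γ) (spanSubgroup Γ (fun _ : V => Multiplicative ℤ) Λ) := by
  classical
  have := Fintype.ofFinite V
  let f : ∀ _ : V, Multiplicative ℤ →* RAAG Γ := fun u => if u ∈ Λ then vertexHom Γ (fun _ : V => Multiplicative ℤ) u else 1
  have hf : Pairwise fun u w => ∀ a b, Commute (f u a) (f w b) := by
    intro u w huw a b
    by_cases hu : u ∈ Λ <;> by_cases hw : w ∈ Λ <;> simp [f, hu, hw]
    exact commute_vertexHom (G := fun _ : V => Multiplicative ℤ) (hΛ hu hw huw) a b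
  have key : ∀ g ∈ spanSubgroup Γ (fun _ : V => Multiplicative ℤ) Λ,
      MonoidHom.noncommPiCoprod f hf (exponents Γ g) = g := by
    intro g hg
    refine spanSubgroup_induction
      (p := fun g => MonoidHom.noncommPiCoprod f hf (exponents Γ g) = g) ?_ ?_ ?_ ?_ hg
    · intro u hu a
      rw [exponents_vertexHom, MonoidHom.noncommPiCoprod_mulSingle]
      simp [f, hu]
    · rw [map_one, map_one]
    · intro g h _ _ h1 h2
      rw [map_mul, map_mul, h1, h2]
    · intro g _ h1
      rw [map_inv, map_inv, h1]
  intro g hg h hh he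
  rw [← key g hg, he, key h hh]

theorem exists_abs_exponents_le [Finite V] {S : Set (RAAG Γ)} (hfin : S.Finite)
    (hS : Subgroup.closure S = ⊤) :
    ∃ C : ℕ, ∀ g u, (exponents Γ g u).toAdd.natAbs ≤ C * wordLength S g := by
  obtain ⟨C, hC⟩ : ∃ C : ℕ, ∀ s ∈ S, ∀ u, (exponents Γ s u).toAdd.natAbs ≤ C := by
    have h1 : (S ×ˢ (Set.univ : Set V)).Finite := hfin.prod Set.finite_univ
    obtain ⟨C, hC⟩ := (h1.image fun x => (exponents Γ x.1 x.2).toAdd.natAbs).bddAbove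
    exact ⟨C, fun s hs u => hC ⟨(s, u), ⟨hs, trivial⟩, rfl⟩⟩
  refine ⟨C, fun g u => ?_⟩
  obtain ⟨l, hl, hlS, rfl⟩ := exists_word hS g
  rw [← hl]
  clear hl
  induction l with
  | nil => simp
  | cons x l ih =>
    have h1 := ih fun y hy => hlS y (List.mem_cons_of_mem _ hy)
    have h2 : (exponents Γ x u).toAdd.natAbs ≤ C := by
      rcases hlS x List.mem_cons_self with h | h
      · exact hC x h u
      · have := hC _ h u
        rwa [map_inv, Pi.inv_apply, toAdd_inv, Int.natAbs_neg] at this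
    rw [List.prod_cons, map_mul, Pi.mul_apply, toAdd_mul, List.length_cons, mul_add, mul_one]
    exact (Int.natAbs_add_le _ _).trans (by omega)

/-- Cosets of clique-subgroups of a right-angled Artin group have polynomial growth, of degree the
clique number. -/
theorem exists_encard_cliqueCoset_inter_le [Finite V] {S : Set (RAAG Γ)} (hfin : S.Finite)
    (hS : Subgroup.closure S = ⊤) :
    ∃ C : ℕ, ∀ A ∈ cliqueCosets Γ (fun _ : V => Multiplicative ℤ), ∀ a ∈ A, ∀ n : ℕ,
      {x ∈ A | wordLength S (a⁻¹ * x) ≤ n}.encard ≤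
        (((2 * C * n + 1) ^ Γ.cliqueNum : ℕ) : ℕ∞) := by
  classical
  have := Fintype.ofFinite V
  obtain ⟨C, hC⟩ := exists_abs_exponents_le hfin hS
  refine ⟨C, ?_⟩
  rintro _ ⟨Λ, g, hΛ, rfl⟩ a ha n
  have hdiff : ∀ x ∈ (fun h => g * h) '' (spanSubgroup Γ (fun _ : V => Multiplicative ℤ) Λ : Set _),
      a⁻¹ * x ∈ spanSubgroup Γ (fun _ : V => Multiplicative ℤ) Λ := by
    rintro _ ⟨h, hh, rfl⟩
    obtain ⟨h', hh', rfl⟩ := ha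
    have : (g * h')⁻¹ * (g * h) = h'⁻¹ * h := by group
    exact this ▸ mul_mem (inv_mem hh') hh
  -- Exponents of elements of length at most `n` are at most `C * n` in absolute value. The ball in
  -- the coset thus injects into a box of dimension `|Λ|`.
  let F : Finset (Λ → ℤ) := Fintype.piFinset fun _ => Finset.Icc (-(C * n : ℤ)) (C * n)
  let f : RAAG Γ → Λ → ℤ := fun x u => (exponents Γ (a⁻¹ * x) u).toAdd
  have hF : F.card ≤ (2 * C * n + 1) ^ Γ.cliqueNum := by
    have h1 : F.card = (2 * C * n + 1) ^ Fintype.card Λ := by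
      rw [Fintype.card_piFinset, Finset.prod_const, Finset.card_univ, Int.card_Icc]
      congr 1
      have : ((C * n : ℤ) + 1 - -(C * n : ℤ)) = ((2 * C * n + 1 : ℕ) : ℤ) := by
        push_cast
        ring
      rw [this, Int.toNat_natCast]
    rw [h1]
    clear hdiff
    refine Nat.pow_le_pow_right (by omega) ?_
    rw [← Set.toFinset_card]
    exact SimpleGraph.IsClique.card_le_cliqueNum (t := Λ.toFinset) (tc := by rwa [Set.coe_toFinset])
  refine le_trans ?_ (Nat.cast_le.2 hF)
  rw [← Set.encard_coe_eq_coe_finsetCard]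
  refine Set.encard_le_encard_of_injOn (f := f) ?_ ?_
  · rintro x ⟨hxA, hxn⟩
    rw [Finset.mem_coe, Fintype.mem_piFinset]
    intro u
    have h2 := (hC (a⁻¹ * x) u).trans (Nat.mul_le_mul_left C hxn)
    have h3 : |f x u| ≤ C * n := by
      rw [Int.abs_eq_natAbs]
      exact_mod_cast h2
    exact Finset.mem_Icc.2 (abs_le.1 h3)
  · rintro x ⟨hxA, -⟩ y ⟨hyA, -⟩ hxy
    have h1 : a⁻¹ * x = a⁻¹ * y := by
      refine exponents_injOn_of_isClique hΛ (hdiff x hxA) (hdiff y hyA) (funext fun u => ?_)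
      by_cases hu : u ∈ Λ
      · exact Multiplicative.toAdd.injective (congrFun hxy ⟨u, hu⟩)
      · rw [exponents_eq_one_of_notMem (hdiff x hxA) hu,
          exponents_eq_one_of_notMem (hdiff y hyA) hu]
    exact mul_left_cancel h1

theorem exists_encard_inter_closedBall_le [Finite V] {S : Set (RAAG Γ)} (hfin : S.Finite)
    (hS : Subgroup.closure S = ⊤) :
    ∃ C : ℕ, ∀ A : Set (WordSpace S hS), A ∈ cliqueCosets Γ (fun _ : V => Multiplicative ℤ) →
      ∀ a ∈ A, ∀ n : ℕ,
        (A ∩ Metric.closedBall a n).encard ≤ (((2 * C * n + 1) ^ Γ.cliqueNum : ℕ) : ℕ∞) := by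
  obtain ⟨C, hC⟩ := exists_encard_cliqueCoset_inter_le hfin hS
  refine ⟨C, fun A hA a ha n => (Set.encard_le_encard ?_).trans (hC A hA a ha n)⟩
  rintro x ⟨hxA, hxn⟩
  rw [Metric.mem_closedBall, dist_comm] at hxn
  refine ⟨hxA, ?_⟩
  have h1 : ((wordLength S ((show RAAG Γ from a)⁻¹ * (show RAAG Γ from x)) : ℕ) : ℝ) ≤ n := hxn
  exact_mod_cast h1

end Exponents

/-! ### Graphs of bounded degree -/

section BoundedDegree

variable {W : Type*} {X : SimpleGraph W}

theorem exists_finset_ball (hd : HasBoundedDegree X) (hX : X.Connected) (n : ℕ) :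
    ∃ N : ℕ, ∀ x, ∃ F : Finset W, F.card ≤ N ∧ ∀ y, X.dist x y ≤ n → y ∈ F := by
  classical
  obtain ⟨d, hd⟩ := hd
  induction n with
  | zero => exact ⟨1, fun x => ⟨{x}, by simp, fun y hy => by
      have := hX.dist_eq_zero_iff.1 (Nat.le_zero.1 hy)
      simp [this]⟩⟩
  | succ n ih =>
    obtain ⟨N, hN⟩ := ih
    choose F hF1 hF2 using hN
    refine ⟨(d + 1) * N, fun x => ?_⟩
    have hfin : (X.neighborSet x).Finite := Set.finite_of_encard_le_coe (hd x)
    refine ⟨(insert x hfin.toFinset).biUnion F, ?_, ?_⟩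
    · refine (Finset.card_biUnion_le_card_mul _ _ N fun z _ => hF1 z).trans ?_
      refine Nat.mul_le_mul_right N ((Finset.card_insert_le _ _).trans (Nat.succ_le_succ ?_))
      have := hd x
      rw [hfin.encard_eq_coe_toFinset_card] at this
      exact_mod_cast this
    · intro y hy
      rw [Finset.mem_biUnion]
      obtain ⟨w, hw⟩ := hX.exists_walk_length_eq_dist x y
      cases w with
      | nil => exact ⟨x, by simp, hF2 _ _ (by simp)⟩
      | @cons _ z _ h w =>
        refine ⟨z, by simp [h], hF2 _ _ ?_⟩
        have := SimpleGraph.dist_le w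
        rw [SimpleGraph.Walk.length_cons] at hw
        omega

theorem exists_le_dist [Infinite W] (hd : HasBoundedDegree X) (hX : X.Connected) (x : W) (n : ℕ) :
    ∃ y, n < X.dist x y := by
  by_contra h
  push Not at h
  obtain ⟨N, hN⟩ := exists_finset_ball hd hX n
  obtain ⟨F, -, hF⟩ := hN x
  exact Set.infinite_univ (F.finite_toSet.subset fun y _ => hF y (h y))

theorem graphSpace_dist (hX : X.Connected) (x y : GraphSpace X hX) :
    dist x y = ((X.dist (show W from x) (show W from y) : ℕ) : ℝ) := rfl

theorem graphSpace_dist_le_one (hX : X.Connected) {x y : W} (h : X.Adj x y) :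
    @dist (GraphSpace X hX) _ x y ≤ 1 := by
  change ((X.dist x y : ℕ) : ℝ) ≤ 1
  exact_mod_cast (SimpleGraph.dist_eq_one_iff_adj.2 h).le

theorem dist_le_mul_dist {Y : Type*} [MetricSpace Y] (hX : X.Connected)
    {ρ : GraphSpace X hX → Y} {k : ℝ} (hk : ∀ x y, dist x y ≤ 1 → dist (ρ x) (ρ y) ≤ k)
    (x y : GraphSpace X hX) : dist (ρ x) (ρ y) ≤ k * dist x y := by
  obtain ⟨w, hw⟩ := hX.exists_walk_length_eq_dist (show W from x) (show W from y)
  rw [graphSpace_dist, ← hw]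
  have key : ∀ (x y : W) (w : X.Walk x y), dist (ρ x) (ρ y) ≤ k * w.length := by
    intro x y w
    induction w with
    | nil => simp
    | @cons x z y h w ih =>
      have h1 : dist (ρ x) (ρ z) ≤ k := hk x z (graphSpace_dist_le_one hX h)
      have h2 := dist_triangle (ρ x) (ρ z) (ρ y)
      rw [SimpleGraph.Walk.length_cons]
      push_cast
      linarith
  exact key x y w

theorem isCoarselyConnected_univ (hX : X.Connected) :
    IsCoarselyConnected 1 (Set.univ : Set (GraphSpace X hX)) := by
  intro x _ y _
  obtain ⟨w, -⟩ := hX.exists_walk_length_eq_dist (show W from x) (show W from y)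
  exact ⟨w.length, w.getVert, w.getVert_zero, w.getVert_length, fun _ _ => trivial, fun i hi =>
    graphSpace_dist_le_one hX (w.adj_getVert_succ hi)⟩

/-- Spheres coarsely separate an infinite connected graph of bounded degree. -/
theorem coarselySeparatedBy_univ [Infinite W] (hd : HasBoundedDegree X) (hX : X.Connected) :
    CoarselySeparatedBy (Set.univ : Set (GraphSpace X hX)) Set.univ := by
  refine ⟨1, 0, zero_le_one, le_rfl, isCoarselyConnected_univ hX, fun D hD => ?_⟩
  obtain ⟨x⟩ := hX.nonempty
  -- The sphere of radius `n` about `x` is at distance at least `n` from both `x` and a point beyond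
  -- distance `2 * n`. The extra 1 keeps `n` positive when `D = 0`, so that these points avoid the
  -- closed 0-neighbourhood.
  set n := ⌈D⌉₊ + 1
  have hDn : D ≤ n := (Nat.le_ceil D).trans (by simp [n])
  obtain ⟨y, hy⟩ := exists_le_dist hd hX x (2 * n)
  let Z : Set (GraphSpace X hX) := {z | X.dist x z = n}
  have hfar : ∀ a : W, (∀ z : W, X.dist x z = n → n ≤ X.dist a z) →
      ENNReal.ofReal n ≤ Metric.infEDist (show GraphSpace X hX from a) Z := by
    intro a ha
    refine Metric.le_infEDist.2 fun z hz => ?_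
    rw [edist_dist]
    refine ENNReal.ofReal_le_ofReal ?_
    rw [graphSpace_dist]
    exact_mod_cast ha z hz
  have hx := hfar x fun z hz => hz.ge
  have hy' := hfar y fun z hz => by
    have := hX.dist_triangle (u := x) (v := z) (w := y)
    rw [SimpleGraph.dist_comm (u := y)]
    omega
  have hn : (0 : ℝ) < n := by positivity
  refine ⟨Z, trivial, x, ⟨trivial, notMem_cthickening_of_le_infEDist hx le_rfl hn⟩, y,
    ⟨trivial, notMem_cthickening_of_le_infEDist hy' le_rfl hn⟩,
    (ENNReal.ofReal_le_ofReal hDn).trans hx, (ENNReal.ofReal_le_ofReal hDn).trans hy', ?_⟩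
  rintro ⟨m, p, p0, pm, hp, hstep⟩
  have hpZ : ∀ i ≤ m, X.dist x (p i) ≠ n := fun i hi h =>
    (hp i hi).2 (Metric.self_subset_cthickening _ h)
  have hlt : ∀ i ≤ m, X.dist x (p i) < n := by
    intro i
    induction i with
    | zero =>
      intro _
      rw [p0, SimpleGraph.dist_self]
      simp [n]
    | succ i ih =>
      intro hi
      have h1 := ih (by omega)
      have h2 := hpZ _ hi
      have h3 : X.dist (p i) (p (i + 1)) ≤ 1 := by
        have := hstep i hi
        rw [graphSpace_dist] at this
        exact_mod_cast this
      have h4 := hX.dist_triangle (u := x) (v := p i) (w := p (i + 1))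
      omega
  have := hlt m le_rfl
  rw [pm] at this
  omega

variable {V : Type*} [Finite V] {Γ : SimpleGraph V}

/-- Sets sent by a coarse embedding close to cosets of clique-subgroups have polynomial growth. -/
theorem hasGrowthBigO_of_near_cliqueCosets (hd : HasBoundedDegree X) (hX : X.Connected)
    {S : Set (RAAG Γ)} (hfin : S.Finite) (hS : Subgroup.closure S = ⊤)
    {ρ : GraphSpace X hX → WordSpace S hS} (hρ : IsCoarseEmbedding ρ) {M : ℝ}
    {𝒮 : Set (Set (GraphSpace X hX))} (h𝒮 : ∀ T ∈ 𝒮, ∃ A : Set (WordSpace S hS),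
      A ∈ cliqueCosets Γ (fun _ : V => Multiplicative ℤ) ∧ ∀ x ∈ T, ∃ a ∈ A, dist (ρ x) a ≤ M) :
    HasGrowthBigO 𝒮 Γ.cliqueNum := by
  classical
  obtain ⟨C, hC⟩ := exists_encard_inter_closedBall_le hfin hS
  obtain ⟨k, hk0, hk⟩ := hρ.exists_dist_le 1
  obtain ⟨M', -, hM'⟩ := hρ.exists_dist_le_of_dist_le (2 * M)
  obtain ⟨N, hN⟩ := exists_finset_ball hd hX ⌈M'⌉₊
  -- the bound on the cardinality of balls
  have key : ∀ T ∈ 𝒮, ∀ s ∈ T, ∀ r : ℝ, ∀ n : ℕ, k * r + 2 * M ≤ n →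
      (Metric.closedBall s r ∩ T).encard ≤ ((N * (2 * C * n + 1) ^ Γ.cliqueNum : ℕ) : ℕ∞) := by
    intro T hT s hs r n hn
    obtain ⟨A, hA, hTA⟩ := h𝒮 T hT
    have : Nonempty (WordSpace S hS) := ⟨ρ s⟩
    choose! f hfA hfd using hTA
    have hballfin : (Metric.closedBall s r ∩ T).Finite := by
      obtain ⟨N', hN'⟩ := exists_finset_ball hd hX ⌈r⌉₊
      obtain ⟨F, -, hF⟩ := hN' s
      refine F.finite_toSet.subset fun (y : GraphSpace X hX) hy => hF y ?_
      have h1 : dist s y ≤ r := by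
        rw [dist_comm]
        exact hy.1
      rw [graphSpace_dist] at h1
      exact_mod_cast h1.trans (Nat.le_ceil r)
    rw [hballfin.encard_eq_coe_toFinset_card, Nat.cast_le]
    -- Points with the same image under `f` have `ρ`-images at distance at most `2 * M`, hence are
    -- at distance at most `M'` from each other. A fibre has at most `N` points.
    have h1 : hballfin.toFinset.card ≤ N * (hballfin.toFinset.image f).card := by
      refine Finset.card_le_mul_card_image _ N fun b hb => ?_
      obtain ⟨x, hx, rfl⟩ := Finset.mem_image.1 hb
      obtain ⟨F, hF, hF'⟩ := hN x
      refine (Finset.card_le_card fun (y : GraphSpace X hX) hy => hF' y ?_).trans hF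
      obtain ⟨hy1, hy2⟩ := Finset.mem_filter.1 hy
      have hyT := ((Set.Finite.mem_toFinset _).1 hy1).2
      have hxT := ((Set.Finite.mem_toFinset _).1 hx).2
      have h2 : dist x y ≤ M' := by
        refine hM' x y ?_
        have h3 := hfd x hxT
        have h4 := hfd y hyT
        rw [hy2, dist_comm] at h4
        linarith [dist_triangle (ρ x) (f x) (ρ y)]
      rw [graphSpace_dist] at h2
      exact_mod_cast h2.trans (Nat.le_ceil M')
    refine h1.trans (Nat.mul_le_mul_left N ?_)
    have h2 : ((hballfin.toFinset.image f : Finset _) : Set (WordSpace S hS)) ⊆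
        A ∩ Metric.closedBall (f s) n := by
      intro b hb
      obtain ⟨x, hx, rfl⟩ := Finset.mem_image.1 (Finset.mem_coe.1 hb)
      obtain ⟨hxs, hxT⟩ := (Set.Finite.mem_toFinset _).1 hx
      refine ⟨hfA x hxT, ?_⟩
      rw [Metric.mem_closedBall] at hxs ⊢
      have h3 := hfd x hxT
      have h4 := hfd s hs
      have h5 := dist_le_mul_dist hX hk x s
      have h6 := mul_le_mul_of_nonneg_left hxs hk0
      rw [dist_comm] at h3
      linarith [dist_triangle4 (f x) (ρ x) (ρ s) (f s)]
    have h3 := (Set.encard_le_encard h2).trans (hC A hA (f s) (hfA s hs) n)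
    rw [Set.encard_coe_eq_coe_finsetCard] at h3
    exact_mod_cast h3
  let E : ℝ := 2 * C * (k + 2 * |M| + 1) + 1
  have hE : 0 ≤ E := by positivity
  refine ⟨Real.toNNReal (N * E ^ Γ.cliqueNum), ?_⟩
  filter_upwards [Filter.eventually_ge_atTop 1] with r hr
  set n := ⌈k * r + 2 * |M|⌉₊
  have hr0 : 0 ≤ r := zero_le_one.trans hr
  have hvol : volumeGrowth 𝒮 r ≤ ((N * (2 * C * n + 1) ^ Γ.cliqueNum : ℕ) : ℕ∞) := by
    refine iSup₂_le fun T hT => iSup₂_le fun s hs => key T hT s hs r n ?_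
    have := le_abs_self M
    exact le_trans (by linarith) (Nat.le_ceil _)
  have hn : (n : ℝ) ≤ (k + 2 * |M| + 1) * r := by
    have h1 := (Nat.ceil_lt_add_one (a := k * r + 2 * |M|) (by positivity)).le
    have h2 := mul_le_mul_of_nonneg_left hr (abs_nonneg M)
    nlinarith
  have hn' : (2 * C * n + 1 : ℝ) ≤ E * r := by
    have h1 := mul_le_mul_of_nonneg_left hn (show (0 : ℝ) ≤ 2 * C by positivity)
    simp only [E]
    nlinarith
  have h1 : ((N * (2 * C * n + 1) ^ Γ.cliqueNum : ℕ) : ℝ) ≤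
      N * E ^ Γ.cliqueNum * r ^ Γ.cliqueNum := by
    push_cast
    rw [mul_assoc (N : ℝ) (E ^ _), ← mul_pow]
    gcongr
  calc (volumeGrowth 𝒮 r : ENNReal)
      ≤ ((((N * (2 * C * n + 1) ^ Γ.cliqueNum : ℕ) : ℕ∞)) : ENNReal) :=
        ENat.toENNReal_mono hvol
    _ = ENNReal.ofReal ((N * (2 * C * n + 1) ^ Γ.cliqueNum : ℕ) : ℝ) := by
        rw [ENNReal.ofReal_natCast, ENat.toENNReal_coe]
    _ ≤ ENNReal.ofReal (N * E ^ Γ.cliqueNum * r ^ Γ.cliqueNum) := ENNReal.ofReal_le_ofReal h1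
    _ = _ := by
        rw [ENNReal.ofReal_mul (by positivity), ENNReal.ofReal_pow hr0]
        rfl

/-- If the image is near one coset, every family of subsets of `X` has the forbidden growth, and the
family of all subsets separates `X`. Otherwise the preimages of `L`-neighbourhoods do: a 1-path
avoiding such a preimage maps to a `k`-path avoiding the neighbourhood. -/
theorem not_isCoarseEmbedding_of_not_coarselySeparatedBy (hΓ : IsChordal Γ) [Infinite W]
    (hd : HasBoundedDegree X) (hX : X.Connected)
    (hsep : ¬ ∃ 𝒮 : Set (Set (GraphSpace X hX)), HasGrowthBigO 𝒮 Γ.cliqueNum ∧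
      CoarselySeparatedBy Set.univ 𝒮)
    {S : Set (RAAG Γ)} (hfin : S.Finite) (hS : Subgroup.closure S = ⊤)
    (ρ : GraphSpace X hX → WordSpace S hS) : ¬ IsCoarseEmbedding ρ := by
  intro hρ
  obtain ⟨k, hk0, hk⟩ := hρ.exists_dist_le 1
  rcases near_or_separatedAt_wordSpace hΓ hfin hS (Set.range ρ) k with
    ⟨A, hA, R, hR⟩ | ⟨L, hL, hL'⟩
  · exact hsep ⟨Set.univ, hasGrowthBigO_of_near_cliqueCosets hd hX hfin hS hρ (M := R)
      (fun T _ => ⟨A, hA, fun x _ => hR _ ⟨x, rfl⟩⟩), coarselySeparatedBy_univ hd hX⟩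
  refine hsep ⟨(fun A => ρ ⁻¹' Metric.cthickening L A) '' cliqueCosets Γ _,
    hasGrowthBigO_of_near_cliqueCosets hd hX hfin hS hρ (M := L + 1) ?_,
    1, 0, zero_le_one, le_rfl, isCoarselyConnected_univ hX, fun D hD => ?_⟩
  · rintro _ ⟨A, hA, rfl⟩
    refine ⟨A, hA, fun x hx => exists_dist_le_of_not_le_infEDist fun h => ?_⟩
    exact notMem_cthickening_of_le_infEDist h hL (by linarith) hx
  -- `D + 1` rather than `D` keeps the distance positive, as exclusion from the closed
  -- 0-neighbourhood requires. Likewise `L + 1` below allows for an infimum distance that is not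
  -- attained.
  obtain ⟨k', hk'0, hk'⟩ := hρ.exists_dist_le (D + 1)
  obtain ⟨A, hA, _, ⟨⟨x, rfl⟩, -⟩, _, ⟨⟨y, rfl⟩, -⟩, hx, hy, hxy⟩ :=
    hL' (k' + (L + 1) + 1) (by positivity)
  have hfar : ∀ x, ENNReal.ofReal (k' + (L + 1) + 1) ≤ Metric.infEDist (ρ x) A →
      ENNReal.ofReal (D + 1) ≤ Metric.infEDist x (ρ ⁻¹' Metric.cthickening L A) := by
    intro x hx
    by_contra h
    obtain ⟨z, hz, hd⟩ := exists_dist_le_of_not_le_infEDist h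
    obtain ⟨a, ha, had⟩ := exists_dist_le_of_not_le_infEDist
      (fun h => notMem_cthickening_of_le_infEDist h hL (lt_add_one L) hz)
    have h1 := dist_triangle (ρ x) (ρ z) a
    have h2 := hk' x z hd
    have h3 := hx.trans (Metric.infEDist_le_edist_of_mem ha)
    rw [edist_dist, ENNReal.ofReal_le_ofReal_iff dist_nonneg] at h3
    linarith
  have hD : ENNReal.ofReal D ≤ ENNReal.ofReal (D + 1) := ENNReal.ofReal_le_ofReal (by linarith)
  refine ⟨_, ⟨A, hA, rfl⟩, x, ⟨trivial, notMem_cthickening_of_le_infEDist (hfar x hx) le_rfl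
    (by positivity)⟩, y, ⟨trivial, notMem_cthickening_of_le_infEDist (hfar y hy) le_rfl
    (by positivity)⟩, hD.trans (hfar x hx), hD.trans (hfar y hy), ?_⟩
  rintro ⟨n, p, p0, pn, hp, hstep⟩
  exact hxy ⟨n, fun i => ρ (p i), congrArg ρ p0, congrArg ρ pn, fun i hi => ⟨⟨_, rfl⟩, fun h =>
    (hp i hi).2 (Metric.self_subset_cthickening _ h)⟩, fun i hi => hk _ _ (hstep i hi)⟩

end BoundedDegree

/-! ### Concatenation and reversal of coarse paths -/

section Paths

theorem JoinedByPath.trans {X : Type*} [MetricSpace X] {k : ℝ} {U : Set X} {a b c : X}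
    (hab : JoinedByPath k U a b) (hbc : JoinedByPath k U b c) : JoinedByPath k U a c := by
  obtain ⟨n, p, p0, pn, hp, hp'⟩ := hab
  obtain ⟨m, q, q0, qm, hq, hq'⟩ := hbc
  refine ⟨n + m, fun i => if i ≤ n then p i else q (i - n), by simpa using p0, ?_, ?_, ?_⟩
  · rcases Nat.eq_zero_or_pos m with rfl | hm
    · simp [pn, ← q0, qm]
    · simpa [hm.ne'] using qm
  · intro i hi
    by_cases h : i ≤ n
    · simpa [h] using hp i h
    · simpa [h] using hq (i - n) (by omega)
  · intro i hi
    rcases lt_trichotomy i n with h | h | h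
    · simpa [h.le, Nat.succ_le_of_lt h] using hp' i h
    · subst h
      have := hq' 0 (by omega)
      rw [q0, ← pn] at this
      simpa using this
    · have h1 : i + 1 - n = i - n + 1 := by omega
      simpa [h.not_ge, show ¬ i + 1 ≤ n by omega, h1] using hq' (i - n) (by omega)

theorem JoinedByPath.symm {X : Type*} [MetricSpace X] {k : ℝ} {U : Set X} {a b : X}
    (hab : JoinedByPath k U a b) : JoinedByPath k U b a := by
  obtain ⟨n, p, p0, pn, hp, hp'⟩ := hab
  refine ⟨n, fun i => p (n - i), by simpa using pn, by simpa using p0, fun i _ =>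
    hp _ (Nat.sub_le _ _), fun i hi => ?_⟩
  have h := hp' (n - (i + 1)) (by omega)
  rw [dist_comm]
  rwa [show n - (i + 1) + 1 = n - i by omega] at h

end Paths

/-! ### Distance estimates in the upper half-space -/

namespace Hyperbolic3

theorem dist_pt_sq (p q : Hyperbolic3) : dist p.pt q.pt ^ 2 =
    (p.pt 0 - q.pt 0) ^ 2 + (p.pt 1 - q.pt 1) ^ 2 + (p.pt 2 - q.pt 2) ^ 2 := by
  rw [EuclideanSpace.dist_sq_eq, Fin.sum_univ_three]
  simp only [Real.dist_eq, sq_abs]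

theorem sq_sub_le_dist_pt_sq (p q : Hyperbolic3) (j : Fin 3) :
    (p.pt j - q.pt j) ^ 2 ≤ dist p.pt q.pt ^ 2 := by
  rw [dist_pt_sq]
  have h0 := sq_nonneg (p.pt 0 - q.pt 0)
  have h1 := sq_nonneg (p.pt 1 - q.pt 1)
  have h2 := sq_nonneg (p.pt 2 - q.pt 2)
  fin_cases j <;> simp <;> linarith

theorem dist_le_div {p q : Hyperbolic3} {m : ℝ} (hm : 0 < m) (hp : m ≤ p.pt 2) (hq : m ≤ q.pt 2) :
    dist p q ≤ dist p.pt q.pt / m := by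
  have h1 : m ≤ √(p.pt 2 * q.pt 2) := Real.le_sqrt_of_sq_le (by nlinarith)
  have h2 : 0 ≤ dist p.pt q.pt / (2 * √(p.pt 2 * q.pt 2)) := by positivity
  have h3 : Real.arsinh (dist p.pt q.pt / (2 * √(p.pt 2 * q.pt 2))) ≤
      dist p.pt q.pt / (2 * √(p.pt 2 * q.pt 2)) := by
    have := Real.self_le_sinh_iff.2 (Real.arsinh_nonneg_iff.2 h2)
    rwa [Real.sinh_arsinh] at this
  rw [dist_eq]
  calc 2 * Real.arsinh (dist p.pt q.pt / (2 * √(p.pt 2 * q.pt 2)))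
      ≤ 2 * (dist p.pt q.pt / (2 * √(p.pt 2 * q.pt 2))) := by linarith
    _ = dist p.pt q.pt / √(p.pt 2 * q.pt 2) := by field_simp
    _ ≤ dist p.pt q.pt / m := by gcongr

theorem sq_sinh_half_dist (p q : Hyperbolic3) :
    4 * Real.sinh (dist p q / 2) ^ 2 = dist p.pt q.pt ^ 2 / (p.pt 2 * q.pt 2) := by
  have h := mul_pos p.pos q.pos
  rw [sinh_half_dist, div_pow, mul_pow, Real.sq_sqrt h.le]
  field_simp
  ring

/-- With `c` and `s` the hyperbolic cosine and sine of half the distance, `(c + s)² ≤ 2(c² + s²) = 2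
+ 4s²`. With `le_exp_dist`, where `4 + 4s² = 4c² ≤ 4(c + s)²`, this compares `exp (dist p q)` with a
rational function of the coordinates. -/
theorem exp_dist_le (p q : Hyperbolic3) :
    Real.exp (dist p q) ≤ 4 + dist p.pt q.pt ^ 2 / (p.pt 2 * q.pt 2) := by
  rw [← sq_sinh_half_dist]
  have h1 : Real.exp (dist p q) = Real.exp (dist p q / 2) ^ 2 := by
    rw [← Real.exp_nat_mul]
    congr 1
    push_cast
    ring
  rw [h1, ← Real.cosh_add_sinh]
  have h2 := Real.cosh_sq (dist p q / 2)
  nlinarith [sq_nonneg (Real.cosh (dist p q / 2) - Real.sinh (dist p q / 2))]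

theorem le_exp_dist (p q : Hyperbolic3) :
    4 + dist p.pt q.pt ^ 2 / (p.pt 2 * q.pt 2) ≤ 4 * Real.exp (dist p q) := by
  rw [← sq_sinh_half_dist]
  have h1 : Real.exp (dist p q) = Real.exp (dist p q / 2) ^ 2 := by
    rw [← Real.exp_nat_mul]
    congr 1
    push_cast
    ring
  rw [h1, ← Real.cosh_add_sinh]
  have h2 := Real.cosh_sq (dist p q / 2)
  have h3 : 0 ≤ Real.sinh (dist p q / 2) := Real.sinh_nonneg_iff.2 (by positivity)
  have h4 := Real.cosh_pos (dist p q / 2)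
  nlinarith [mul_nonneg h3 h4.le, sq_nonneg (Real.sinh (dist p q / 2))]

/-- Points at bounded hyperbolic distance have comparable heights and Euclidean distance bounded in
terms of the heights. -/
theorem exists_coord_bounds (M : ℝ) : ∃ κ : ℝ, 1 ≤ κ ∧ ∀ p q : Hyperbolic3, dist p q ≤ M →
    q.pt 2 ≤ κ * p.pt 2 ∧ ∀ j, |p.pt j - q.pt j| ≤ κ * q.pt 2 := by
  have hK : 0 < 4 * Real.exp M := by positivity
  refine ⟨4 * Real.exp M + 2, by linarith, fun p q hpq => ?_⟩
  have hp := p.pos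
  have hq := q.pos
  have h1 : dist p.pt q.pt ^ 2 ≤ 4 * Real.exp M * (p.pt 2 * q.pt 2) := by
    have h2 := le_exp_dist p q
    have h3 := Real.exp_le_exp.2 hpq
    rw [← div_le_iff₀ (mul_pos hp hq)]
    linarith
  have key : ∀ a b : ℝ, 0 < a → 0 < b → (a - b) ^ 2 ≤ 4 * Real.exp M * (a * b) →
      b ≤ (4 * Real.exp M + 2) * a := by
    intro a b ha hb h
    refine le_of_mul_le_mul_right (a := b) ?_ hb
    nlinarith [sq_nonneg a]
  have h2 := (sq_sub_le_dist_pt_sq p q 2).trans h1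
  have h3 := key _ _ hp hq h2
  have h4 := key _ _ hq hp (by rw [mul_comm (q.pt 2)]; nlinarith)
  refine ⟨h3, fun j => abs_le_of_sq_le_sq ?_ (by positivity)⟩
  have h5 := (sq_sub_le_dist_pt_sq p q j).trans h1
  have h6 := mul_le_mul_of_nonneg_right h4 hq.le
  have h7 := mul_le_mul_of_nonneg_left h6 hK.le
  nlinarith [mul_pos hq hq, mul_pos hK (mul_pos hq hq)]

/-- A bound on the height of a point by its distance to a reference point. -/
theorem height_le {x p : Hyperbolic3} {β : ℝ} (hβ : 1 ≤ β) (h0 : |p.pt 0 - x.pt 0| ≤ β * x.pt 2)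
    (h1 : |p.pt 1 - x.pt 1| ≤ β * x.pt 2) (h2 : p.pt 2 ≤ β * x.pt 2) :
    p.pt 2 ≤ (4 * β + 3 * β ^ 2) * x.pt 2 * Real.exp (-dist x p) := by
  have hx := x.pos
  have hp := p.pos
  rw [Real.exp_neg, ← div_eq_mul_inv, le_div_iff₀ (Real.exp_pos _)]
  have h3 := exp_dist_le x p
  have h4 : dist x.pt p.pt ^ 2 ≤ 3 * β ^ 2 * x.pt 2 ^ 2 := by
    rw [dist_pt_sq]
    have e0 := sq_le_sq' (abs_le.1 h0).1 (abs_le.1 h0).2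
    have e1 := sq_le_sq' (abs_le.1 h1).1 (abs_le.1 h1).2
    have e2 : (p.pt 2 - x.pt 2) ^ 2 ≤ (β * x.pt 2) ^ 2 :=
      sq_le_sq' (by nlinarith) (by linarith)
    nlinarith
  have h5 : p.pt 2 * Real.exp (dist x p) ≤
      p.pt 2 * (4 + dist x.pt p.pt ^ 2 / (x.pt 2 * p.pt 2)) :=
    mul_le_mul_of_nonneg_left h3 hp.le
  have h6 : p.pt 2 * (4 + dist x.pt p.pt ^ 2 / (x.pt 2 * p.pt 2)) =
      4 * p.pt 2 + dist x.pt p.pt ^ 2 / x.pt 2 := by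
    field_simp
  have h7 : dist x.pt p.pt ^ 2 / x.pt 2 ≤ 3 * β ^ 2 * x.pt 2 := by
    rw [div_le_iff₀ hx]
    linarith
  linarith

/-- The Euclidean segment between two points is a coarse path, for any positive step. -/
theorem joinedByPath_segment {k : ℝ} (hk : 0 < k) {U : Set Hyperbolic3} {z w : Hyperbolic3}
    (hU : ∀ p : Hyperbolic3, (∃ t ∈ Set.Icc (0 : ℝ) 1, ∀ i, p.pt i = (1 - t) * z.pt i + t * w.pt i) →
      p ∈ U) : JoinedByPath k U z w := by
  have hz := z.pos
  have hw := w.pos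
  set m := min (z.pt 2) (w.pt 2)
  have hm : 0 < m := lt_min hz hw
  have hcoord : ∀ (t : ℝ) (i : Fin 3),
      (AffineMap.lineMap z.pt w.pt t : EuclideanSpace ℝ (Fin 3)) i =
        (1 - t) * z.pt i + t * w.pt i := by
    intro t i
    rw [AffineMap.lineMap_apply_module]
    simp
  have hge : ∀ t ∈ Set.Icc (0 : ℝ) 1,
      m ≤ (AffineMap.lineMap z.pt w.pt t : EuclideanSpace ℝ (Fin 3)) 2 := by
    intro t ht
    rw [hcoord]
    have h1 := mul_le_mul_of_nonneg_left (min_le_left (z.pt 2) (w.pt 2)) (sub_nonneg.2 ht.2)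
    have h2 := mul_le_mul_of_nonneg_left (min_le_right (z.pt 2) (w.pt 2)) ht.1
    linarith
  let γ : ℝ → Hyperbolic3 := fun t =>
    if h : t ∈ Set.Icc (0 : ℝ) 1 then ⟨AffineMap.lineMap z.pt w.pt t, hm.trans_le (hge t h)⟩ else z
  have hγ : ∀ t ∈ Set.Icc (0 : ℝ) 1, (γ t).pt = AffineMap.lineMap z.pt w.pt t := fun t ht => by
    simp only [γ, dif_pos ht]
  have hext : ∀ p q : Hyperbolic3, p.pt = q.pt → p = q := by
    rintro ⟨p, hp⟩ ⟨q, hq⟩ rfl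
    rfl
  -- On the segment the height is at least `m`, so a Euclidean step of length at most `m * k` is a
  -- hyperbolic step of length at most `k`.
  set n := ⌈dist z.pt w.pt / (m * k)⌉₊ + 1
  have hn : (0 : ℝ) < n := by positivity
  have hmem : ∀ i ≤ n, (i / n : ℝ) ∈ Set.Icc (0 : ℝ) 1 := fun i hi =>
    ⟨by positivity, (div_le_one hn).2 (by exact_mod_cast hi)⟩
  refine ⟨n, fun i => γ (i / n), hext _ _ ?_, hext _ _ ?_, fun i hi => hU _ ⟨i / n, hmem i hi, ?_⟩,
    fun i hi => ?_⟩
  · rw [hγ _ (hmem 0 (Nat.zero_le _))]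
    simp
  · rw [hγ _ (hmem n le_rfl), div_self hn.ne']
    simp
  · intro j
    rw [hγ _ (hmem i hi), hcoord]
  · have h1 := hmem i hi.le
    have h2 := hmem (i + 1) hi
    refine (dist_le_div hm (by rw [hγ _ h1]; exact hge _ h1)
      (by rw [hγ _ h2]; exact hge _ h2)).trans ?_
    rw [hγ _ h1, hγ _ h2, dist_lineMap_lineMap, Real.dist_eq]
    have h3 : ((i : ℝ) / n - ((i + 1 : ℕ) : ℝ) / n) = -(1 / n) := by
      push_cast
      field_simp
      ring
    rw [h3, abs_neg, abs_of_pos (by positivity)]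
    have h4 : dist z.pt w.pt / (m * k) ≤ n := (Nat.le_ceil _).trans (by simp [n])
    rw [div_le_iff₀ (by positivity)] at h4
    rw [div_le_iff₀ hm, one_div, inv_mul_le_iff₀ hn]
    linarith

end Hyperbolic3

open MeasureTheory

/-! ### Exponential sums over families of polynomial growth -/

section PolynomialGrowth

/-- The balls of radius `n` around points of the family `s` contain at most `(E (n + 1)) ^ m` points
of the family. -/
def HasPolyGrowth {I X : Type*} [MetricSpace X] (s : I → X) (E m : ℕ) : Prop :=
  ∀ (i : I) (n : ℕ), {i' | dist (s i) (s i') ≤ n}.encard ≤ (((E * (n + 1)) ^ m : ℕ) : ℕ∞)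

/-- The centre need not belong to the family; moving it to a member of the ball doubles the radius.
-/
theorem HasPolyGrowth.encard_le {I X : Type*} [MetricSpace X] {s : I → X} {E m : ℕ}
    (hs : HasPolyGrowth s E m) (x : X) (n : ℕ) :
    {i | dist x (s i) ≤ n}.encard ≤ (((E * (2 * n + 1)) ^ m : ℕ) : ℕ∞) := by
  rcases Set.eq_empty_or_nonempty {i | dist x (s i) ≤ n} with h | ⟨i₀, h₀⟩
  · rw [h, Set.encard_empty]
    exact zero_le
  · refine (Set.encard_le_encard fun i hi => ?_).trans (hs i₀ (2 * n))
    have h1 : dist x (s i) ≤ n := hi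
    have h2 : dist (s i₀) x ≤ n := by
      rw [dist_comm]
      exact h₀
    have h3 := dist_triangle (s i₀) x (s i)
    change dist (s i₀) (s i) ≤ ((2 * n : ℕ) : ℝ)
    push_cast
    linarith

/-- The term of `i` is at most `exp (1 - n)` for `n = ⌈dist x (s i)⌉₊`, and the indices with a given
`n` are counted by the whole ball of radius `n`. Balls of radius less than `D` are empty. -/
theorem tsum_exp_neg_dist_le {I X : Type*} [MetricSpace X] {s : I → X} {E m : ℕ}
    (hs : HasPolyGrowth s E m) (x : X) (D : ℕ) (hD : ∀ i, D ≤ dist x (s i)) :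
    ∑' i, ENNReal.ofReal (Real.exp (-dist x (s i))) ≤
      ∑' k : ℕ, ENNReal.ofReal (Real.exp (1 - ((k + D : ℕ) : ℝ)) *
        ((E * (2 * (k + D) + 1)) ^ m : ℕ)) := by
  classical
  let T : ℕ → Set I := fun n => {i | dist x (s i) ≤ n}
  let a : ℕ → ENNReal := fun n => ENNReal.ofReal (Real.exp (1 - (n : ℝ)))
  have h1 : ∀ i, ENNReal.ofReal (Real.exp (-dist x (s i))) ≤
      ∑' n, (T n).indicator (fun _ => a n) i := by
    intro i
    refine le_trans ?_ (ENNReal.le_tsum ⌈dist x (s i)⌉₊)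
    have hmem : i ∈ T ⌈dist x (s i)⌉₊ :=
      show dist x (s i) ≤ (⌈dist x (s i)⌉₊ : ℝ) from Nat.le_ceil _
    rw [Set.indicator_of_mem hmem]
    refine ENNReal.ofReal_le_ofReal (Real.exp_le_exp.2 ?_)
    have := Nat.ceil_lt_add_one (dist_nonneg (x := x) (y := s i))
    linarith
  have h2 : ∀ n, ∑' i, (T n).indicator (fun _ => a n) i = (T n).encard * a n := by
    intro n
    rw [← tsum_subtype, ENNReal.tsum_set_const]
  have h3 : ∀ n < D, ((T n).encard : ENNReal) * a n = 0 := by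
    intro n hn
    have : T n = ∅ := by
      refine Set.eq_empty_of_forall_notMem fun i hi => ?_
      have h4 : dist x (s i) ≤ n := hi
      have h5 : (n : ℝ) < D := by exact_mod_cast hn
      linarith [hD i]
    simp [this]
  calc ∑' i, ENNReal.ofReal (Real.exp (-dist x (s i)))
      ≤ ∑' i, ∑' n, (T n).indicator (fun _ => a n) i := ENNReal.tsum_le_tsum h1
    _ = ∑' n, ((T n).encard : ENNReal) * a n := by
        rw [ENNReal.tsum_comm]
        simp_rw [h2]
    _ = ∑' k, ((T (k + D)).encard : ENNReal) * a (k + D) := by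
        rw [← ENNReal.summable.sum_add_tsum_nat_add' (k := D),
          Finset.sum_eq_zero fun n hn => h3 n (Finset.mem_range.1 hn), zero_add]
    _ ≤ _ := by
        refine ENNReal.tsum_le_tsum fun k => ?_
        rw [mul_comm, ENNReal.ofReal_mul (Real.exp_pos _).le, ENNReal.ofReal_natCast]
        refine mul_le_mul_right ?_ _
        have := ENat.toENNReal_mono (hs.encard_le x (k + D))
        rwa [ENat.toENNReal_coe] at this

theorem tsum_exp_mul_pow_ne_top (E m : ℕ) :
    ∑' n : ℕ, ENNReal.ofReal (Real.exp (1 - (n : ℝ)) * ((E * (2 * n + 1)) ^ m : ℕ)) ≠ ⊤ := by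
  refine Summable.tsum_ofReal_ne_top ?_
  have h1 := (summable_nat_add_iff 1).2 (Real.summable_pow_mul_exp_neg_nat_mul m one_pos)
  refine Summable.of_nonneg_of_le (fun n => by positivity) (fun n => ?_)
    (h1.mul_left (Real.exp 2 * (2 * E) ^ m))
  have h2 : Real.exp (1 - (n : ℝ)) = Real.exp 2 * Real.exp (-1 * ((n + 1 : ℕ) : ℝ)) := by
    rw [← Real.exp_add]
    congr 1
    push_cast
    ring
  have h3 : (((E * (2 * n + 1)) ^ m : ℕ) : ℝ) ≤ (2 * E) ^ m * ((n + 1 : ℕ) : ℝ) ^ m := by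
    rw [← mul_pow]
    push_cast
    refine pow_le_pow_left₀ (by positivity) ?_ m
    nlinarith [(Nat.cast_nonneg E : (0 : ℝ) ≤ E)]
  rw [h2]
  calc Real.exp 2 * Real.exp (-1 * ((n + 1 : ℕ) : ℝ)) * (((E * (2 * n + 1)) ^ m : ℕ) : ℝ)
      ≤ Real.exp 2 * Real.exp (-1 * ((n + 1 : ℕ) : ℝ)) *
        ((2 * E) ^ m * ((n + 1 : ℕ) : ℝ) ^ m) := by gcongr
    _ = _ := by ring

/-- The sum is at most the tail from `D` of a convergent series that depends only on `E` and `m`, so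
`D` serves all families at once. -/
theorem exists_tsum_exp_neg_dist_le (E m : ℕ) {ε : ℝ} (hε : 0 < ε) : ∃ D : ℕ,
    ∀ {I X : Type*} [MetricSpace X] {s : I → X}, HasPolyGrowth s E m → ∀ x : X,
      (∀ i, D ≤ dist x (s i)) →
        ∑' i, ENNReal.ofReal (Real.exp (-dist x (s i))) ≤ ENNReal.ofReal ε := by
  have h := ENNReal.tendsto_sum_nat_add _ (tsum_exp_mul_pow_ne_top E m)
  obtain ⟨D, hD⟩ := (h.eventually_le_const (ENNReal.ofReal_pos.2 hε)).exists
  refine ⟨D, fun hs x hx => (tsum_exp_neg_dist_le hs x D hx).trans (le_trans (le_of_eq ?_) hD)⟩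
  push_cast
  rfl

theorem HasPolyGrowth.tsum_ne_top {I X : Type*} [MetricSpace X] {s : I → X} {E m : ℕ}
    (hs : HasPolyGrowth s E m) (x : X) :
    ∑' i, ENNReal.ofReal (Real.exp (-dist x (s i))) ≠ ⊤ := by
  refine ne_top_of_le_ne_top (tsum_exp_mul_pow_ne_top E m) ?_
  simpa using tsum_exp_neg_dist_le hs x 0 (by simp)

theorem HasPolyGrowth.countable {I X : Type*} [MetricSpace X] {s : I → X} {E m : ℕ}
    (hs : HasPolyGrowth s E m) : Countable I := by
  rcases isEmpty_or_nonempty I with h | ⟨⟨i⟩⟩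
  · infer_instance
  · have h1 := Summable.countable_support_ennreal (hs.tsum_ne_top (s i))
    rw [← Set.countable_univ_iff]
    refine h1.mono fun i' _ => ?_
    rw [Function.mem_support]
    exact (ENNReal.ofReal_pos.2 (Real.exp_pos _)).ne'

end PolynomialGrowth

/-! ### Vertical lines avoiding a family of polynomial growth -/

namespace Hyperbolic3

/-- The values `b` for which `p`, in a box around `x`, may be close to a point whose `j`-th
coordinate is `b`. -/
def badInterval (κ β : ℝ) (x : Hyperbolic3) (j : Fin 3) (p : Hyperbolic3) : Set ℝ :=
  {b | (∀ l, l ≠ 2 → |p.pt l - x.pt l| ≤ β * x.pt 2) ∧ p.pt 2 ≤ β * x.pt 2 ∧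
    |b - p.pt j| ≤ κ * p.pt 2}

/-- The interval has length `2 * κ` times the height of `p`, and `height_le` makes this height
exponentially small in the distance from `x` when `p` lies in the box. -/
theorem volume_badInterval_le {κ β : ℝ} (hκ : 0 ≤ κ) (hβ : 1 ≤ β) (x : Hyperbolic3) (j : Fin 3)
    (p : Hyperbolic3) : volume (badInterval κ β x j p) ≤
      ENNReal.ofReal (2 * κ * (4 * β + 3 * β ^ 2) * x.pt 2) *
        ENNReal.ofReal (Real.exp (-dist x p)) := by
  by_cases h : (∀ l, l ≠ 2 → |p.pt l - x.pt l| ≤ β * x.pt 2) ∧ p.pt 2 ≤ β * x.pt 2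
  · have h1 := height_le hβ (h.1 0 (by decide)) (h.1 1 (by decide)) h.2
    have h2 : badInterval κ β x j p ⊆ Set.Icc (p.pt j - κ * p.pt 2) (p.pt j + κ * p.pt 2) := by
      rintro b ⟨-, -, hb⟩
      rw [abs_le] at hb
      exact ⟨by linarith, by linarith⟩
    have hx := x.pos
    refine (measure_mono h2).trans ?_
    rw [Real.volume_Icc, ← ENNReal.ofReal_mul (by positivity)]
    refine ENNReal.ofReal_le_ofReal ?_
    have := mul_le_mul_of_nonneg_left h1 (show 0 ≤ 2 * κ by positivity)
    linarith
  · have h2 : badInterval κ β x j p = ∅ :=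
      Set.eq_empty_of_forall_notMem fun b hb => h ⟨hb.1, hb.2.1⟩
    rw [h2, measure_empty]
    exact zero_le

section Avoiding

variable {I : Type*} {s : I → Hyperbolic3} {E m : ℕ} {M κ : ℝ}

theorem tsum_volume_badInterval_le (hκ : 0 ≤ κ) {β : ℝ} (hβ : 1 ≤ β) (x : Hyperbolic3)
    (j : Fin 3) : ∑' i, volume (badInterval κ β x j (s i)) ≤
      ENNReal.ofReal (2 * κ * (4 * β + 3 * β ^ 2) * x.pt 2) *
        ∑' i, ENNReal.ofReal (Real.exp (-dist x (s i))) := by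
  rw [← ENNReal.tsum_mul_left]
  exact ENNReal.tsum_le_tsum fun i => volume_badInterval_le hκ hβ x j (s i)

theorem mem_badInterval (h1κ : 1 ≤ κ) (hκ : ∀ p q : Hyperbolic3, dist p q ≤ M →
    q.pt 2 ≤ κ * p.pt 2 ∧ ∀ j, |p.pt j - q.pt j| ≤ κ * q.pt 2) {x z p : Hyperbolic3} {j j' : Fin 3}
    (hj : ∀ l, l ≠ 2 → l = j ∨ l = j') {R : ℝ} (hR : 0 ≤ R)
    (hzj : z.pt j ∈ Set.Icc (x.pt j) (x.pt j + x.pt 2)) (hzj' : |z.pt j' - x.pt j'| ≤ R * x.pt 2)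
    (hz : z.pt 2 ≤ x.pt 2) (hzp : dist z p ≤ M) :
    z.pt j ∈ badInterval κ (κ ^ 2 + 2 + R) x j p := by
  obtain ⟨h1, h2⟩ := hκ z p hzp
  have hx := x.pos
  have h3 : p.pt 2 ≤ κ * x.pt 2 := h1.trans (by gcongr)
  have h4 : κ * p.pt 2 ≤ κ ^ 2 * x.pt 2 := by
    have := mul_le_mul_of_nonneg_left h3 (zero_le_one.trans h1κ)
    linarith
  have h5 : κ * x.pt 2 ≤ (κ ^ 2 + 2 + R) * x.pt 2 := by
    refine mul_le_mul_of_nonneg_right ?_ hx.le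
    nlinarith
  refine ⟨fun l hl => ?_, h3.trans h5, h2 j⟩
  have h6 := h2 l
  rw [abs_sub_comm] at h6
  have h7 := abs_sub_le (p.pt l) (z.pt l) (x.pt l)
  rcases hj l hl with rfl | rfl
  · have h8 : |z.pt l - x.pt l| ≤ x.pt 2 := by
      rw [abs_le]
      exact ⟨by linarith [hzj.1], by linarith [hzj.2]⟩
    nlinarith [mul_nonneg hR hx.le]
  · nlinarith

/-- For almost every value of the `j`-th coordinate, points of small height avoid the
neighbourhoods of the points of the family. -/
theorem ae_exists_height (hs : HasPolyGrowth s E m) (h1κ : 1 ≤ κ)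
    (hκ : ∀ p q : Hyperbolic3, dist p q ≤ M →
      q.pt 2 ≤ κ * p.pt 2 ∧ ∀ j, |p.pt j - q.pt j| ≤ κ * q.pt 2) (x : Hyperbolic3) {j j' : Fin 3}
    (hj : ∀ l, l ≠ 2 → l = j ∨ l = j') {R : ℝ} (hR : 0 ≤ R) :
    ∀ᵐ b : ℝ, b ∈ Set.Icc (x.pt j) (x.pt j + x.pt 2) → ∃ η > 0, ∀ z : Hyperbolic3,
      z.pt j = b → |z.pt j' - x.pt j'| ≤ R → z.pt 2 ≤ η → ∀ i, M < dist z (s i) := by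
  have := hs.countable
  have hx := x.pos
  set β := κ ^ 2 + 2 + R / x.pt 2
  have hβ : 1 ≤ β := by
    have : 0 ≤ R / x.pt 2 := by positivity
    have := sq_nonneg κ
    simp only [β]
    linarith
  -- By Borel–Cantelli almost every `b` is bad for finitely many `i` only; it then suffices that `κ
  -- * η` is below the heights of these finitely many points.
  have hfin := ae_finite_setOfPred_mem (μ := (volume : Measure ℝ))
    (s := fun i => badInterval κ β x j (s i))
    (ne_top_of_le_ne_top (ENNReal.mul_ne_top ENNReal.ofReal_ne_top (hs.tsum_ne_top x))
      (tsum_volume_badInterval_le (zero_le_one.trans h1κ) hβ x j))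
  filter_upwards [hfin] with b hb hbI
  have h1 : ∀ᶠ η in nhdsWithin (0 : ℝ) (Set.Ioi 0), ∀ i ∈ {i | b ∈ badInterval κ β x j (s i)},
      κ * η < (s i).pt 2 := by
    refine (Filter.eventually_all_finite hb).2 fun i _ => ?_
    have : Filter.Tendsto (fun η : ℝ => κ * η) (nhdsWithin 0 (Set.Ioi 0)) (nhds (κ * 0)) :=
      ((continuous_const.mul continuous_id).tendsto 0).mono_left nhdsWithin_le_nhds
    refine this.eventually_lt_const ?_
    rw [mul_zero]
    exact (s i).pos
  have h2 : ∀ᶠ η in nhdsWithin (0 : ℝ) (Set.Ioi 0), η ∈ Set.Ioo 0 (x.pt 2) :=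
    Ioo_mem_nhdsGT hx
  obtain ⟨η, h3, h4⟩ := (h1.and h2).exists
  refine ⟨η, h4.1, fun z hzb hzj' hz i => ?_⟩
  by_contra hM
  rw [not_lt] at hM
  have h5 : z.pt j ∈ badInterval κ β x j (s i) := by
    refine mem_badInterval h1κ hκ hj (by positivity) (by rwa [hzb]) ?_ (hz.trans h4.2.le) hM
    rwa [div_mul_cancel₀ _ hx.ne']
  rw [hzb] at h5
  have h6 := h3 i h5
  have h7 := (hκ z (s i) hM).1
  have h8 := mul_le_mul_of_nonneg_left hz (zero_le_one.trans h1κ)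
  linarith

/-- A value of the `j`-th coordinate such that vertical lines below `x`, and points of small
height, avoid the neighbourhoods of the points of the family. -/
theorem exists_good_coordinate (hs : HasPolyGrowth s E m) (h1κ : 1 ≤ κ)
    (hκ : ∀ p q : Hyperbolic3, dist p q ≤ M →
      q.pt 2 ≤ κ * p.pt 2 ∧ ∀ j, |p.pt j - q.pt j| ≤ κ * q.pt 2) (x : Hyperbolic3)
    (hx : ∑' i, ENNReal.ofReal (Real.exp (-dist x (s i))) ≤ ENNReal.ofReal
      (1 / (2 * (2 * κ * (4 * (κ ^ 2 + 2) + 3 * (κ ^ 2 + 2) ^ 2)))))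
    {j j' : Fin 3} (hj : ∀ l, l ≠ 2 → l = j ∨ l = j') {R : ℝ} (hR : 0 ≤ R) :
    ∃ b ∈ Set.Icc (x.pt j) (x.pt j + x.pt 2),
      (∀ z : Hyperbolic3, z.pt j = b → z.pt j' = x.pt j' → z.pt 2 ≤ x.pt 2 →
        ∀ i, M < dist z (s i)) ∧
      ∃ η > 0, ∀ z : Hyperbolic3, z.pt j = b → |z.pt j' - x.pt j'| ≤ R → z.pt 2 ≤ η →
        ∀ i, M < dist z (s i) := by
  by_contra hcon
  push Not at hcon
  have := hs.countable
  have hx0 := x.pos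
  set K := 2 * κ * (4 * (κ ^ 2 + 2) + 3 * (κ ^ 2 + 2) ^ 2) with hK
  have hK0 : 0 < K := by positivity
  -- If no `b` were suitable, the bad intervals would cover almost all of an interval of length
  -- `x.pt 2`. The hypothesis on the sum bounds their total length by half of that.
  have h1 : Set.Icc (x.pt j) (x.pt j + x.pt 2) ≤ᵐ[volume]
      ⋃ i, badInterval κ (κ ^ 2 + 2) x j (s i) := by
    filter_upwards [ae_exists_height hs h1κ hκ x hj hR] with b hb hbI
    obtain ⟨η, hη, hb2⟩ := hb hbI
    by_contra hnot
    have hall : ∀ z : Hyperbolic3, z.pt j = b → z.pt j' = x.pt j' → z.pt 2 ≤ x.pt 2 →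
        ∀ i, M < dist z (s i) := by
      intro z hzb hzj' hz i
      by_contra hM
      rw [not_lt] at hM
      refine hnot (Set.mem_iUnion.2 ⟨i, ?_⟩)
      have := mem_badInterval h1κ hκ hj (R := 0) le_rfl (hzb ▸ hbI) (by simp [hzj']) hz hM
      rwa [hzb, add_zero] at this
    obtain ⟨z, hz1, hz2, hz3, i, hi⟩ := hcon b hbI hall η hη
    exact (hb2 z hz1 hz2 hz3 i).not_ge hi
  have h2 := (measure_mono_ae h1).trans (measure_iUnion_le _)
  have h3 := h2.trans (tsum_volume_badInterval_le (zero_le_one.trans h1κ)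
    (show 1 ≤ κ ^ 2 + 2 by nlinarith) x j)
  have h4 := h3.trans (mul_le_mul_right hx _)
  rw [Real.volume_Icc, ← hK, ← ENNReal.ofReal_mul (by positivity), add_sub_cancel_left,
    ENNReal.ofReal_le_ofReal_iff (by positivity)] at h4
  have h5 : K * x.pt 2 * (1 / (2 * K)) = x.pt 2 / 2 := by field_simp
  linarith

/-- A family of polynomial growth is not coarsely dense in hyperbolic space. -/
theorem exists_forall_lt_dist (hs : HasPolyGrowth s E m) (M : ℝ) :
    ∃ z : Hyperbolic3, ∀ i, M < dist z (s i) := by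
  obtain ⟨κ, h1κ, hκ⟩ := exists_coord_bounds M
  let x : Hyperbolic3 := ⟨!₂[0, 0, 1], by simp⟩
  have h := ae_exists_height hs h1κ hκ x (j := 0) (j' := 1) (by decide) (R := 0) le_rfl
  have hx : (0 : ℝ) < x.pt 2 := x.pos
  have h1 : ∃ b ∈ Set.Icc (x.pt 0) (x.pt 0 + x.pt 2), ∃ η > 0, ∀ z : Hyperbolic3,
      z.pt 0 = b → |z.pt 1 - x.pt 1| ≤ 0 → z.pt 2 ≤ η → ∀ i, M < dist z (s i) := by
    by_contra hcon
    push Not at hcon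
    have h2 : ∀ᵐ b : ℝ, b ∉ Set.Icc (x.pt 0) (x.pt 0 + x.pt 2) := by
      filter_upwards [h] with b hb hbI
      obtain ⟨η, hη, hz⟩ := hb hbI
      obtain ⟨z, h3, h4, h5, i, h6⟩ := hcon b hbI η hη
      exact (hz z h3 h4 h5 i).not_ge h6
    have h3 := measure_eq_zero_iff_ae_notMem.2 h2
    rw [Real.volume_Icc, ENNReal.ofReal_eq_zero] at h3
    linarith
  obtain ⟨b, -, η, hη, hz⟩ := h1
  exact ⟨⟨!₂[b, 0, η], by simpa using hη⟩, hz _ (by simp) (by simp [x]) (by simp)⟩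

end Avoiding

end Hyperbolic3

/-! ### Non-separation and non-embedding of hyperbolic space -/

namespace Hyperbolic3

/-- The point with the given coordinates. -/
def ofCoords (a b c : ℝ) (hc : 0 < c) : Hyperbolic3 := ⟨!₂[a, b, c], by simpa using hc⟩

@[simp] theorem ofCoords_zero (a b c : ℝ) (hc : 0 < c) : (ofCoords a b c hc).pt 0 = a := by simp [ofCoords]
@[simp] theorem ofCoords_one (a b c : ℝ) (hc : 0 < c) : (ofCoords a b c hc).pt 1 = b := by simp [ofCoords]
@[simp] theorem ofCoords_two (a b c : ℝ) (hc : 0 < c) : (ofCoords a b c hc).pt 2 = c := by simp [ofCoords]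

theorem eq_of_coord {p q : Hyperbolic3} (h : ∀ i, p.pt i = q.pt i) : p = q := by
  cases p
  cases q
  simp only [Hyperbolic3.mk.injEq]
  ext i
  exact h i

/-- The part of the path from `x` down to height `η`: a move in the `j`-th direction at constant
height, then a vertical segment. -/
theorem joinedByPath_descent {U : Set Hyperbolic3} {x p q : Hyperbolic3} {j j' : Fin 3}
    (hj : ∀ l, l ≠ 2 → l = j ∨ l = j') (hj2 : j ≠ 2) (hj2' : j' ≠ 2) (hjj : j ≠ j')
    (hU : ∀ z, dist x z ≤ 1 → z ∈ U) (hpj : p.pt j ∈ Set.Icc (x.pt j) (x.pt j + x.pt 2))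
    (hpj' : p.pt j' = x.pt j') (hp2 : p.pt 2 = x.pt 2)
    (hqj : q.pt j = p.pt j) (hqj' : q.pt j' = x.pt j') (hq2 : q.pt 2 ≤ x.pt 2)
    (hU' : ∀ z : Hyperbolic3, z.pt j = p.pt j → z.pt j' = x.pt j' → z.pt 2 ≤ x.pt 2 → z ∈ U) :
    JoinedByPath 1 U x q := by
  refine JoinedByPath.trans (b := p) ?_ ?_
  · refine joinedByPath_segment one_pos ?_
    rintro z ⟨t, ht, hz⟩
    refine hU z ?_
    have hx := x.pos
    have hz2 : z.pt 2 = x.pt 2 := by rw [hz, hp2]; ring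
    have hzj' : z.pt j' = x.pt j' := by rw [hz, hpj']; ring
    refine (dist_le_div hx le_rfl hz2.ge).trans ((div_le_one hx).2 ?_)
    refine abs_le_of_sq_le_sq' ?_ hx.le |>.2
    have h1 : dist x.pt z.pt ^ 2 = (x.pt j - z.pt j) ^ 2 := by
      have h01 : j = 0 ∧ j' = 1 ∨ j = 1 ∧ j' = 0 := by
        revert hj2 hj2' hjj
        revert j j'
        clear *-
        intro j j' _ _ _ _ _ _ _ _ _ _
        omega
      rw [dist_pt_sq]
      rcases h01 with ⟨rfl, rfl⟩ | ⟨rfl, rfl⟩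
      · rw [hzj', hz2]; ring
      · rw [hzj', hz2]; ring
    rw [h1, hz]
    have h2 : x.pt j - ((1 - t) * x.pt j + t * p.pt j) = -(t * (p.pt j - x.pt j)) := by ring
    have h3 : t * (p.pt j - x.pt j) ≤ 1 * x.pt 2 :=
      mul_le_mul ht.2 (by linarith [hpj.2]) (by linarith [hpj.1]) zero_le_one
    have h4 : 0 ≤ t * (p.pt j - x.pt j) := mul_nonneg ht.1 (by linarith [hpj.1])
    rw [h2, neg_sq]
    exact pow_le_pow_left₀ h4 (by linarith) 2
  · refine joinedByPath_segment one_pos ?_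
    rintro z ⟨t, ht, hz⟩
    refine hU' z (by rw [hz, hqj]; ring) (by rw [hz, hpj', hqj']; ring) ?_
    rw [hz, hp2]
    nlinarith [mul_le_mul_of_nonneg_left hq2 ht.1]

/-- Hyperbolic space is not coarsely separated by families of polynomial growth. -/
theorem exists_forall_joinedByPath (E m : ℕ) (M : ℝ) : ∃ D : ℝ, 0 ≤ D ∧
    ∀ {I : Type*} {s : I → Hyperbolic3}, HasPolyGrowth s E m → ∀ x y : Hyperbolic3,
      (∀ i, D ≤ dist x (s i)) → (∀ i, D ≤ dist y (s i)) →
        JoinedByPath 1 {z | ∀ i, M < dist z (s i)} x y := by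
  obtain ⟨κ, h1κ, hκ⟩ := exists_coord_bounds M
  obtain ⟨D, hD⟩ := exists_tsum_exp_neg_dist_le E m
    (show 0 < 1 / (2 * (2 * κ * (4 * (κ ^ 2 + 2) + 3 * (κ ^ 2 + 2) ^ 2))) by positivity)
  -- `M + 2` keeps the unit balls about `x` and `y`, in which the initial horizontal moves take
  -- place, off the `M`-neighbourhoods.
  refine ⟨max (D : ℝ) (M + 2), le_max_of_le_left (Nat.cast_nonneg D), fun {I s} hs x y hx hy => ?_⟩
  have hx2 := x.pos
  have hy2 := y.pos
  have hU : ∀ x : Hyperbolic3, (∀ i, max (D : ℝ) (M + 2) ≤ dist x (s i)) → ∀ z, dist x z ≤ 1 →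
      z ∈ {z | ∀ i, M < dist z (s i)} := by
    intro x hx z hz i
    have h1 := (le_max_right _ _).trans (hx i)
    have h2 := dist_triangle x z (s i)
    linarith
  -- A value `b` of coordinate 1 is chosen below `x` and a value `a` of coordinate 0 below `y`. The
  -- two low horizontal lines they define are perpendicular, so they cross at `(a, b)`. The values
  -- of `R` are large enough for each line to reach that crossing.
  obtain ⟨b, hb, hb1, η, hη, hb2⟩ := exists_good_coordinate hs h1κ hκ x
    (hD hs x fun i => (le_max_left _ _).trans (hx i)) (j := 1) (j' := 0) (by decide)
    (R := |x.pt 0 - y.pt 0| + y.pt 2) (by positivity)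
  obtain ⟨a, ha, ha1, η', hη', ha2⟩ := exists_good_coordinate hs h1κ hκ y
    (hD hs y fun i => (le_max_left _ _).trans (hy i)) (j := 0) (j' := 1) (by decide)
    (R := |x.pt 1 - y.pt 1| + x.pt 2) (by positivity)
  obtain ⟨θ, hθ, h1, h2, h3, h4⟩ : ∃ θ : ℝ, 0 < θ ∧ θ ≤ η ∧ θ ≤ η' ∧ θ ≤ x.pt 2 ∧ θ ≤ y.pt 2 :=
    ⟨min (min η η') (min (x.pt 2) (y.pt 2)), by positivity, by simp, by simp, by simp, by simp⟩
  refine JoinedByPath.trans (b := ofCoords (x.pt 0) b θ hθ) ?_ (JoinedByPath.trans (b := ofCoords a b θ hθ) ?_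
    (JoinedByPath.trans (b := ofCoords a (y.pt 1) θ hθ) ?_ (JoinedByPath.symm ?_)))
  · exact joinedByPath_descent (p := ofCoords (x.pt 0) b (x.pt 2) hx2) (j := 1) (j' := 0) (by decide)
      (by decide) (by decide) (by decide) (hU x hx) (by simpa using hb) (by simp) (by simp)
      (by simp) (by simp) (by simpa using h3) (by simpa using hb1)
  · refine joinedByPath_segment one_pos ?_
    rintro z ⟨t, ht, hz⟩
    have z0 := hz 0
    have z1 := hz 1
    have z2 := hz 2
    simp only [ofCoords_zero, ofCoords_one, ofCoords_two] at z0 z1 z2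
    refine hb2 z (by rw [z1]; ring) ?_ (by rw [z2]; linarith)
    have h5 : z.pt 0 - x.pt 0 = t * (a - x.pt 0) := by rw [z0]; ring
    have h6 : |a - x.pt 0| ≤ |x.pt 0 - y.pt 0| + y.pt 2 := by
      have := abs_le.1 (le_refl |x.pt 0 - y.pt 0|)
      rw [abs_le]
      constructor <;> linarith [ha.1, ha.2]
    rw [h5, abs_mul, abs_of_nonneg ht.1]
    nlinarith [abs_nonneg (a - x.pt 0), ht.2]
  · refine joinedByPath_segment one_pos ?_
    rintro z ⟨t, ht, hz⟩
    have z0 := hz 0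
    have z1 := hz 1
    have z2 := hz 2
    simp only [ofCoords_zero, ofCoords_one, ofCoords_two] at z0 z1 z2
    refine ha2 z (by rw [z0]; ring) ?_ (by rw [z2]; linarith)
    have h5 : z.pt 1 - y.pt 1 = (1 - t) * (b - y.pt 1) := by rw [z1]; ring
    have h6 : |b - y.pt 1| ≤ |x.pt 1 - y.pt 1| + x.pt 2 := by
      have := abs_le.1 (le_refl |x.pt 1 - y.pt 1|)
      rw [abs_le]
      constructor <;> linarith [hb.1, hb.2]
    rw [h5, abs_mul, abs_of_nonneg (sub_nonneg.2 ht.2)]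
    nlinarith [abs_nonneg (b - y.pt 1), ht.1]
  · exact joinedByPath_descent (p := ofCoords a (y.pt 1) (y.pt 2) hy2) (j := 0) (j' := 1) (by decide)
      (by decide) (by decide) (by decide) (hU y hy) (by simpa using ha) (by simp) (by simp)
      (by simp) (by simp) (by simpa using h4) (by simpa using ha1)

section CoarseLipschitz

variable {Y : Type*} [MetricSpace Y] {ρ : Hyperbolic3 → Y} {k : ℝ}

/-- Doubling the height moves a point by at most 1, so `n` doublings cost at most `k * n`. -/
theorem dist_le_of_vertical (hk0 : 0 ≤ k) (hk : ∀ x y, dist x y ≤ 1 → dist (ρ x) (ρ y) ≤ k)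
    (n : ℕ) (a b : ℝ) : ∀ (c d : ℝ) (hc : 0 < c) (hd : 0 < d), c ≤ d → d ≤ 2 ^ n * c →
      dist (ρ (ofCoords a b c hc)) (ρ (ofCoords a b d hd)) ≤ k * n := by
  have hvert : ∀ (c d : ℝ) (hc : 0 < c) (hd : 0 < d), c ≤ d → d ≤ 2 * c →
      dist (ρ (ofCoords a b c hc)) (ρ (ofCoords a b d hd)) ≤ k := by
    intro c d hc hd hcd hdc
    refine hk _ _ ((dist_le_div hc (by simp) (by simpa using hcd)).trans ((div_le_one hc).2 ?_))
    refine abs_le_of_sq_le_sq' ?_ hc.le |>.2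
    rw [dist_pt_sq]
    simp only [ofCoords_zero, ofCoords_one, ofCoords_two]
    nlinarith
  induction n with
  | zero =>
    intro c d hc hd h1 h2
    obtain rfl : c = d := by linarith
    simp
  | succ n ih =>
    intro c d hc hd h1 h2
    push_cast
    by_cases h : d ≤ 2 * c
    · have := hvert c d hc hd h1 h
      nlinarith [mul_nonneg hk0 (Nat.cast_nonneg (α := ℝ) n)]
    · have h3 := hvert c (2 * c) hc (by positivity) (by linarith) le_rfl
      have h4 := ih (2 * c) d (by positivity) hd (by linarith) (by
        rw [pow_succ] at h2
        linarith)
      have h5 := dist_triangle (ρ (ofCoords a b c hc)) (ρ (ofCoords a b (2 * c) (by positivity)))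
        (ρ (ofCoords a b d hd))
      linarith

theorem exists_le_two_pow_mul {c d : ℝ} (hc : 0 < c) (hcd : c ≤ d) :
    ∃ n : ℕ, d ≤ 2 ^ n * c ∧ (n : ℝ) ≤ 2 * Real.log (d / c) + 1 := by
  have h1 : 1 ≤ d / c := (one_le_div hc).2 hcd
  have h0 := Real.log_nonneg h1
  have hl : (1 : ℝ) / 2 ≤ Real.log 2 := by linarith [Real.log_two_gt_d9]
  refine ⟨⌈2 * Real.log (d / c)⌉₊, ?_, (Nat.ceil_lt_add_one (by positivity)).le⟩
  rw [← div_le_iff₀ hc, ← Real.log_le_log_iff (by positivity) (by positivity), Real.log_pow]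
  have h2 := Nat.le_ceil (2 * Real.log (d / c))
  nlinarith

/-- Maps out of hyperbolic space that are bounded on unit balls are coarsely Lipschitz. -/
theorem dist_le_of_bounded (hk0 : 0 ≤ k) (hk : ∀ x y, dist x y ≤ 1 → dist (ρ x) (ρ y) ≤ k)
    (x y : Hyperbolic3) : dist (ρ x) (ρ y) ≤ k * (2 * dist x y + 9) := by
  have hx := x.pos
  have hy := y.pos
  -- At height `H` the horizontal move has hyperbolic length at most 1. The two vertical moves take
  -- a number of doublings logarithmic in `H / x.pt 2` and `H / y.pt 2`, and the product of these
  -- ratios is at most `4 * exp (dist x y)`.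
  set H := max (dist x.pt y.pt) (max (x.pt 2) (y.pt 2)) with hH
  have hxH : x.pt 2 ≤ H := le_max_of_le_right (le_max_left _ _)
  have hyH : y.pt 2 ≤ H := le_max_of_le_right (le_max_right _ _)
  have hH0 : 0 < H := hx.trans_le hxH
  obtain ⟨n, hn, hn'⟩ := exists_le_two_pow_mul hx hxH
  obtain ⟨n', hm, hm'⟩ := exists_le_two_pow_mul hy hyH
  have ex : ofCoords (x.pt 0) (x.pt 1) (x.pt 2) hx = x := eq_of_coord fun i => by
    fin_cases i <;> simp
  have ey : ofCoords (y.pt 0) (y.pt 1) (y.pt 2) hy = y := eq_of_coord fun i => by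
    fin_cases i <;> simp
  have h1 := dist_le_of_vertical hk0 hk n (x.pt 0) (x.pt 1) _ _ hx hH0 hxH hn
  have h2 := dist_le_of_vertical hk0 hk n' (y.pt 0) (y.pt 1) _ _ hy hH0 hyH hm
  rw [ex] at h1
  rw [ey, dist_comm] at h2
  have h3 : dist (ρ (ofCoords (x.pt 0) (x.pt 1) H hH0)) (ρ (ofCoords (y.pt 0) (y.pt 1) H hH0)) ≤ k := by
    refine hk _ _ ((dist_le_div hH0 (by simp) (by simp)).trans ((div_le_one hH0).2 ?_))
    refine le_trans ?_ (le_max_left (dist x.pt y.pt) _)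
    refine abs_le_of_sq_le_sq' ?_ dist_nonneg |>.2
    rw [dist_pt_sq, dist_pt_sq]
    simp only [ofCoords_zero, ofCoords_one, ofCoords_two]
    nlinarith [sq_nonneg (x.pt 2 - y.pt 2)]
  have h4 : Real.log (H / x.pt 2) + Real.log (H / y.pt 2) ≤ dist x y + 3 := by
    rw [← Real.log_mul (by positivity) (by positivity)]
    have h5 : H / x.pt 2 * (H / y.pt 2) ≤ 4 * Real.exp (dist x y) := by
      refine le_trans ?_ (le_exp_dist x y)
      have h6 : H / x.pt 2 * (H / y.pt 2) = H ^ 2 / (x.pt 2 * y.pt 2) := by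
        field_simp
      have hxy := mul_pos hx hy
      rw [h6, div_le_iff₀ hxy, add_mul, div_mul_cancel₀ _ hxy.ne']
      have h7 := sq_sub_le_dist_pt_sq x y 2
      rcases max_choice (dist x.pt y.pt) (max (x.pt 2) (y.pt 2)) with h | h
      · rw [hH, h]
        linarith
      · rcases max_choice (x.pt 2) (y.pt 2) with h' | h'
        · rw [hH, h, h']
          nlinarith
        · rw [hH, h, h']
          nlinarith
    have h8 := Real.log_le_log (by positivity) h5
    rw [Real.log_mul (by norm_num) (Real.exp_pos _).ne', Real.log_exp] at h8
    have h9 := Real.log_le_sub_one_of_pos (show (0 : ℝ) < 4 by norm_num)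
    linarith
  have h5 : k * n + k + k * n' ≤ k * (2 * dist x y + 9) := by
    have : (n : ℝ) + 1 + n' ≤ 2 * dist x y + 9 := by linarith
    nlinarith
  have h6 := dist_triangle4 (ρ x) (ρ (ofCoords (x.pt 0) (x.pt 1) H hH0))
    (ρ (ofCoords (y.pt 0) (y.pt 1) H hH0)) (ρ y)
  linarith

end CoarseLipschitz

/-- Representatives of the points sent near a coset form a family of polynomial growth. They can
neither be coarsely dense, which excludes an image near one coset, nor separate, which excludes the
other case. -/
theorem not_isCoarseEmbedding {V : Type*} [Finite V] {Γ : SimpleGraph V} (hΓ : IsChordal Γ)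
    {S : Set (RAAG Γ)} (hfin : S.Finite) (hS : Subgroup.closure S = ⊤)
    (ρ : Hyperbolic3 → WordSpace S hS) : ¬ IsCoarseEmbedding ρ := by
  intro hρ
  obtain ⟨k, hk0, hk⟩ := hρ.exists_dist_le 1
  obtain ⟨C, hC⟩ := exists_encard_inter_closedBall_le hfin hS
  -- a family of representatives for the set of points sent close to a coset
  have hrep : ∀ M : ℝ, 0 ≤ M → ∃ (E : ℕ) (M' : ℝ), ∀ A : Set (WordSpace S hS),
      A ∈ cliqueCosets Γ (fun _ : V => Multiplicative ℤ) →
        ∃ (I : Set (WordSpace S hS)) (s : I → Hyperbolic3), HasPolyGrowth s E Γ.cliqueNum ∧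
          (∀ i, ∃ a ∈ A, dist (ρ (s i)) a ≤ M) ∧
          ∀ z, (∀ i, M' < dist z (s i)) → ∀ a ∈ A, M < dist (ρ z) a := by
    intro M hM
    obtain ⟨M', -, hM'⟩ := hρ.exists_dist_le_of_dist_le (2 * M)
    set N := ⌈9 * k + 2 * M⌉₊
    refine ⟨2 * C * N + 1, M', fun A hA => ?_⟩
    -- One point is chosen for each coset element near the image, so the index set is a subset of
    -- `A` and inherits its growth. `dist_le_of_bounded` converts a hyperbolic radius `n` into a
    -- word radius at most `N * (n + 1)`.
    choose s hs using fun i : {a : WordSpace S hS | a ∈ A ∧ ∃ x, dist (ρ x) a ≤ M} => i.2.2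
    refine ⟨_, s, fun i n => ?_, fun i => ⟨i, i.2.1, hs i⟩, fun z hz a ha => ?_⟩
    · rw [← Subtype.val_injective.encard_image]
      refine ((Set.encard_le_encard ?_).trans (hC A hA i i.2.1 (N * (n + 1)))).trans ?_
      · rintro _ ⟨i', hi', rfl⟩
        refine ⟨i'.2.1, ?_⟩
        have h1 : dist (s i) (s i') ≤ n := hi'
        have h2 := dist_le_of_bounded hk0 hk (s i) (s i')
        have h3 := hs i
        have h4 := hs i'
        have h5 := Nat.le_ceil (9 * k + 2 * M)
        have h6 : k * (2 * dist (s i) (s i') + 9) ≤ k * (2 * n + 9) := by gcongr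
        rw [dist_comm] at h3
        have h7 := dist_triangle4 (i : WordSpace S hS) (ρ (s i)) (ρ (s i')) i'
        rw [Metric.mem_closedBall, dist_comm]
        push_cast
        have h8 : (9 * k + 2 * M) * (n + 1) ≤ N * (n + 1) := by gcongr
        nlinarith [mul_nonneg hk0 (Nat.cast_nonneg (α := ℝ) n),
          mul_nonneg hM (Nat.cast_nonneg (α := ℝ) n)]
      · rw [Nat.cast_le]
        refine Nat.pow_le_pow_left ?_ _
        nlinarith
    · by_contra hcon
      rw [not_lt] at hcon
      have h1 := hs ⟨a, ha, z, hcon⟩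
      refine (hz ⟨a, ha, z, hcon⟩).not_ge (hM' _ _ ?_)
      rw [dist_comm] at h1
      have h2 := dist_triangle (ρ z) a (ρ (s ⟨a, ha, z, hcon⟩))
      linarith
  rcases near_or_separatedAt_wordSpace hΓ hfin hS (Set.range ρ) k with
    ⟨A, hA, R, hR⟩ | ⟨L, hL, hL'⟩
  · obtain ⟨E, M', h⟩ := hrep (max R 0) (le_max_right _ _)
    obtain ⟨I, s, hs, -, hfar⟩ := h A hA
    obtain ⟨z, hz⟩ := exists_forall_lt_dist hs M'
    obtain ⟨a, ha, had⟩ := hR (ρ z) ⟨z, rfl⟩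
    exact (hfar z hz a ha).not_ge (had.trans (le_max_left _ _))
  · obtain ⟨E, M', h⟩ := hrep (L + 1) (by positivity)
    obtain ⟨D, hD0, hD⟩ := exists_forall_joinedByPath E Γ.cliqueNum M'
    obtain ⟨A, hA, _, ⟨⟨x, rfl⟩, -⟩, _, ⟨⟨y, rfl⟩, -⟩, hx, hy, hxy⟩ :=
      hL' (k * (2 * D + 9) + (L + 1) + 1) (by positivity)
    obtain ⟨I, s, hs, hnear, hfar⟩ := h A hA
    have hdist : ∀ x, ENNReal.ofReal (k * (2 * D + 9) + (L + 1) + 1) ≤ Metric.infEDist (ρ x) A →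
        ∀ i, D ≤ dist x (s i) := by
      intro x hx i
      by_contra hlt
      rw [not_le] at hlt
      obtain ⟨a, ha, had⟩ := hnear i
      have h1 := dist_le_of_bounded hk0 hk x (s i)
      have h2 : k * (2 * dist x (s i) + 9) ≤ k * (2 * D + 9) := by gcongr
      have h3 := hx.trans (Metric.infEDist_le_edist_of_mem ha)
      rw [edist_dist, ENNReal.ofReal_le_ofReal_iff dist_nonneg] at h3
      linarith [dist_triangle (ρ x) (ρ (s i)) a]
    obtain ⟨n, p, p0, pn, hp, hstep⟩ := hD hs x y (hdist x hx) (hdist y hy)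
    refine hxy ⟨n, fun i => ρ (p i), congrArg ρ p0, congrArg ρ pn, fun i hi => ⟨⟨_, rfl⟩, fun h => ?_⟩,
      fun i hi => hk _ _ (hstep i hi)⟩
    obtain ⟨a, ha, had⟩ := exists_dist_le_of_not_le_infEDist
      (fun h' => notMem_cthickening_of_le_infEDist h' hL (lt_add_one L) h)
    exact (hfar (p i) (hp i hi) a ha).not_ge had

end Hyperbolic3

end ChordalCoarse

end

theorem theorem4p3 {V : Type*} [Finite V] (Γ : SimpleGraph V) (hΓ : ChordalCoarse.IsChordal Γ) :
    -- the dichotomy for graph products of finitely generated groups, for every word metric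
    (∀ (G : V → Type*) [∀ u, Group (G u)] [∀ u, Group.FG (G u)]
        (S : Set (ChordalCoarse.GraphProduct Γ G)) (_ : S.Finite) (hS : Subgroup.closure S = ⊤)
        (Z : Type*) [MetricSpace Z] (_ : ChordalCoarse.IsGeodesicSpace Z)
        (ρ : Z → ChordalCoarse.WordSpace S hS) (_ : ChordalCoarse.IsCoarseEmbedding ρ),
      (∃ A : Set (ChordalCoarse.WordSpace S hS), A ∈ ChordalCoarse.cliqueCosets Γ G ∧
        ∃ R : ℝ, Set.range ρ ⊆ Metric.cthickening R A) ∨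
      ChordalCoarse.CoarselySeparatedBy (Set.range ρ) (ChordalCoarse.cliqueCosets Γ G)) ∧
    -- the consequence for right-angled Artin groups
    (∀ (W : Type*) [Infinite W] (X : SimpleGraph W) (hX : X.Connected)
        (_ : ChordalCoarse.HasBoundedDegree X)
        (_ : ¬ ∃ 𝒮 : Set (Set (ChordalCoarse.GraphSpace X hX)),
          ChordalCoarse.HasGrowthBigO 𝒮 Γ.cliqueNum ∧
          ChordalCoarse.CoarselySeparatedBy Set.univ 𝒮)
        (S : Set (ChordalCoarse.RAAG Γ)) (_ : S.Finite) (hS : Subgroup.closure S = ⊤),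
      ¬ ∃ ρ : ChordalCoarse.GraphSpace X hX → ChordalCoarse.WordSpace S hS,
        ChordalCoarse.IsCoarseEmbedding ρ) ∧
    -- hyperbolic 3-space does not coarsely embed
    (∀ (S : Set (ChordalCoarse.RAAG Γ)) (_ : S.Finite) (hS : Subgroup.closure S = ⊤),
      ¬ ∃ ρ : ChordalCoarse.Hyperbolic3 → ChordalCoarse.WordSpace S hS,
        ChordalCoarse.IsCoarseEmbedding ρ) := by
  refine ⟨?_, ?_, ?_⟩
  · intro G _ _ S hfin hS Z _ hZ ρ hρ
    obtain ⟨k, hk0, hk⟩ := hρ.exists_dist_le 1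
    rcases ChordalCoarse.near_or_separatedAt_wordSpace hΓ hfin hS (Set.range ρ) k with
      ⟨A, hA, R, hR⟩ | ⟨L, hL, hL'⟩
    · refine Or.inl ⟨A, hA, R, fun y hy => ?_⟩
      obtain ⟨a, ha, had⟩ := hR y hy
      exact Metric.mem_cthickening_of_dist_le _ _ _ _ ha had
    · exact Or.inr ⟨k, L, hk0, hL, ChordalCoarse.isCoarselyConnected_range hZ hk, hL'⟩
  · rintro W _ X hX hd hsep S hfin hS ⟨ρ, hρ⟩
    exact ChordalCoarse.not_isCoarseEmbedding_of_not_coarselySeparatedBy hΓ hd hX hsep hfin hS ρ hρ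
  · rintro S hfin hS ⟨ρ, hρ⟩
    exact ChordalCoarse.Hyperbolic3.not_isCoarseEmbedding hΓ hfin hS ρ hρ
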